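/- Conventions. Let $d\ge 1$. Let $\lambda_k$ be the $k$-dimensional Hausdorff measure on $\mathbb{R}^d$, normalized to agree with Lebesgue measure on $k$-dimensional affine subspaces; let $\omega_k$ be the volume of the Euclidean unit ball of $\mathbb{R}^k$, and let $\sigma$ be $\lambda_{d-1}$ restricted to the unit sphere $S^{d-1}$. A convex polytope is the convex hull of finitely many points, and a convex body is a compact convex set with nonempty interior. For $A\subseteq\mathbb{R}^d$ let $\operatorname{cone}(A)=\{\gamma x: x\in A,\ \gamma\ge 0\}$ and $A^\circ=\{y:\langle x,y\rangle\le 1\ \text{for all } x\in A\}$. Funk surface area. Let $K$ be a convex body and $x\in\operatorname{int}K$. The Funk–Finsler norm at $x$ of a vector $w\neq 0$ is $1/t$, where $t>0$ and $x+tw\in\partial K$, and it is $0$ for $w=0$. Its unit ball is $B_K(x)=K-x$. For a convex body $G\subset\operatorname{int}K$ and $x\in\partial G$, let $T_x$ be the tangent space of $\partial G$ at $x$ (the hyperplane through the origin orthogonal to the outer unit normal, which is unique for $\lambda_{d-1}$-almost every $x\in\partial G$). The Holmes–Thompson surface area of $G$ in the Funk geometry of $K$ is $$\mathrm{area}_K(G)=\frac1{\omega_{d-1}}\int_{\partial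 G}\lambda_{d-1}\big(\{y\in T_x:\langle w,y\rangle\le 1\ \text{for all } w\in B_K(x)\cap T_x\}\big)\,d\lambda_{d-1}(x).$$ Cone Funk volume. For pointed convex cones $C,D\subset\mathbb{R}^d$ with nonempty interior and with $D\setminus\{0\}\subset\operatorname{int}C$, put $$\mathrm{vol}_C(D)=\frac1{\omega_{d-1}}\int_{S^{d-1}\cap D}\lambda_{d-1}(F_C(s))\,d\sigma(s),\qquad F_C(s)=\{y\in C^\circ:\langle s,y\rangle=-1\}.$$ Theorem (Vertex decomposition). Let $K\subset\mathbb{R}^d$ be a convex polytope with vertex set $V(K)$ and let $G\subset\operatorname{int}K$ be a convex body. For $v\in V(K)$ let $K_v=\operatorname{cone}(K-v)$ and $G_v=\operatorname{cone}(G-v)$. Then $$\mathrm{area}_K(G)=\sum_{v\in V(K)}\mathrm{vol}_{K_v}(G_v).$$ -/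

import Mathlib

open MeasureTheory
open scoped ENNReal RealInnerProductSpace

namespace Funk

variable {d : ℕ}

/-- A convex body: a compact convex set with nonempty interior. -/
def IsConvexBody (G : Set (EuclideanSpace ℝ (Fin d))) : Prop :=
  IsCompact G ∧ Convex ℝ G ∧ (interior G).Nonempty

/-- A convex polytope: the convex hull of finitely many points. -/
def IsConvexPolytope (K : Set (EuclideanSpace ℝ (Fin d))) : Prop :=
  ∃ S : Finset (EuclideanSpace ℝ (Fin d)), K = convexHull ℝ (S : Set (EuclideanSpace ℝ (Fin d)))

/-- The vertices of a convex polytope are its extreme points. -/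
def vertices (K : Set (EuclideanSpace ℝ (Fin d))) : Set (EuclideanSpace ℝ (Fin d)) :=
  K.extremePoints ℝ

/-- The translate `A - v`. -/
def translateBy (A : Set (EuclideanSpace ℝ (Fin d))) (v : EuclideanSpace ℝ (Fin d)) :
    Set (EuclideanSpace ℝ (Fin d)) :=
  (fun x => x - v) '' A

/-- The conical hull `{γ x | x ∈ A, γ ≥ 0}`. -/
def cone (A : Set (EuclideanSpace ℝ (Fin d))) : Set (EuclideanSpace ℝ (Fin d)) :=
  {z | ∃ γ : ℝ, 0 ≤ γ ∧ ∃ x ∈ A, z = γ • x}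

/-- The (one-sided) polar `{y | ⟨x, y⟩ ≤ 1 for all x ∈ A}`. -/
def polar (A : Set (EuclideanSpace ℝ (Fin d))) : Set (EuclideanSpace ℝ (Fin d)) :=
  {y | ∀ x ∈ A, ⟪x, y⟫ ≤ 1}

/-- The polar taken inside a linear subspace `T`. -/
def polarIn (T : Submodule ℝ (EuclideanSpace ℝ (Fin d))) (A : Set (EuclideanSpace ℝ (Fin d))) :
    Set (EuclideanSpace ℝ (Fin d)) :=
  {y | y ∈ T ∧ ∀ x ∈ A, ⟪x, y⟫ ≤ 1}

/-- The cone of outer normal vectors of `G` at `x`. -/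
def normalCone (G : Set (EuclideanSpace ℝ (Fin d))) (x : EuclideanSpace ℝ (Fin d)) :
    Set (EuclideanSpace ℝ (Fin d)) :=
  {u | ∀ y ∈ G, ⟪u, y - x⟫ ≤ 0}

/-- The tangent space `T_x` at a boundary point `x` of a convex body `G`, as a linear subspace: the
vectors orthogonal to all outer normals at `x`. Where the outer unit normal `u` is unique (almost
everywhere on the boundary) this is the hyperplane orthogonal to `u`. At the remaining boundary
points, a null set, its dimension is smaller than `d - 1`. -/
noncomputable def tangentSpace (G : Set (EuclideanSpace ℝ (Fin d))) (x : EuclideanSpace ℝ (Fin d)) :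
    Submodule ℝ (EuclideanSpace ℝ (Fin d)) :=
  (Submodule.span ℝ (normalCone G x))ᗮ

/-- The Funk-Finsler norm at an interior point `x` of `K`: it is `0` at `v = 0`, and otherwise
`1 / t`, where `x + t v` is the point at which the ray from `x` in direction `v` leaves `K`. -/
noncomputable def finslerNorm (K : Set (EuclideanSpace ℝ (Fin d)))
    (x v : EuclideanSpace ℝ (Fin d)) : ℝ :=
  open Classical in if v = 0 then 0 else 1 / sSup {t : ℝ | x + t • v ∈ K}

/-- The Finsler ball at `x`, that is, the unit ball of the Funk-Finsler norm in the tangent space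
at `x`. For `K` a convex body and `x` in its interior it equals `K - x`. -/
def finslerBall (K : Set (EuclideanSpace ℝ (Fin d))) (x : EuclideanSpace ℝ (Fin d)) :
    Set (EuclideanSpace ℝ (Fin d)) :=
  {v | finslerNorm K x v ≤ 1}

/-- The Lebesgue volume `ω_k` of the Euclidean unit ball in `ℝ^k`. -/
noncomputable def unitBallVolume (k : ℕ) : ℝ≥0∞ :=
  volume (Metric.closedBall (0 : EuclideanSpace ℝ (Fin k)) 1)

/-- The density of the Holmes-Thompson (Funk) surface-area element at `x ∈ ∂G` with respect to
the `(d - 1)`-dimensional Hausdorff measure. `μHE[k]` is the `k`-dimensional Hausdorff measure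
normalized so that it agrees with Lebesgue measure on `k`-dimensional Euclidean spaces. -/
noncomputable def areaDensity (K G : Set (EuclideanSpace ℝ (Fin d)))
    (x : EuclideanSpace ℝ (Fin d)) : ℝ≥0∞ :=
  (unitBallVolume (d - 1))⁻¹ *
    μHE[d - 1] (polarIn (tangentSpace G x) (finslerBall K x ∩ tangentSpace G x))

/-- The Holmes-Thompson surface area of `G` in the Funk geometry induced by `K`. -/
noncomputable def area (K G : Set (EuclideanSpace ℝ (Fin d))) : ℝ≥0∞ :=
  ∫⁻ x in frontier G, areaDensity K G x ∂μHE[d - 1]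

/-- The dual cross-section `F_C(x) = C° ∩ (-x)^*` of the polar cone of `C`. -/
def dualCrossSection (C : Set (EuclideanSpace ℝ (Fin d))) (x : EuclideanSpace ℝ (Fin d)) :
    Set (EuclideanSpace ℝ (Fin d)) :=
  {y | y ∈ polar C ∧ ⟪x, y⟫ = -1}

/-- The cone Funk volume of the cone `D` relative to the cone `C`; the surface measure on the
unit sphere is the restriction of the `(d - 1)`-dimensional Hausdorff measure. -/
noncomputable def coneVolume (C D : Set (EuclideanSpace ℝ (Fin d))) : ℝ≥0∞ :=
  (unitBallVolume (d - 1))⁻¹ *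
    ∫⁻ s in Metric.sphere (0 : EuclideanSpace ℝ (Fin d)) 1 ∩ D,
      μHE[d - 1] (dualCrossSection C s) ∂μHE[d - 1]

end Funk

/-! Let x be a boundary point of G with unique outer unit normal u. Inside u^⊥, the polar of (K - x)
∩ u^⊥ is the orthogonal projection of the polar of K - x. That polar has one facet for each vertex
v, lying in ⟨v - x, y⟩ = 1, and this facet is exactly F_{K_v}(x - v). The facets with ⟨v - x, u⟩ > 0
cover the projection with null overlaps, and each shrinks by the cosine ⟨v - x, u⟩ / |x - v|. Hence
the area density at x is a sum over the vertices (`measure_polarIn_section`).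

Fix v. Only the part of ∂G visible from v contributes, and radial projection from v carries it onto
S^{d-1} ∩ G_v up to null sets. The solid angle element is the cosine times |x - v|^{-(d-1)} dλ.
Since the polar of K_v is a cone, F_{K_v}(x - v) is F_{K_v}(s) divided by |x - v|, where s is the
direction of x - v, and this supplies precisely the power |x - v|^{-(d-1)}. The term of v thus
becomes its cone volume (`lintegral_frontier_eq_lintegral_sphere_inter_cone`).

To make this rigorous, sphere and visible boundary are both parametrized by rays from v over an
affine hyperplane. The inverse of the entry parameter is concave, so the entry map is locally
Lipschitz, hence differentiable almost everywhere, and differentiability forces a unique normal. The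
area formula `lintegral_image_eq_lintegral_normDet_mul` turns both integrals into integrals over the
same parameter set, where the integrands agree pointwise (`normDet_entryDeriv_mul`). -/

namespace Funk

open Set Filter Topology Module Metric
open scoped NNReal Pointwise

set_option linter.unusedSectionVars false

/-! ### Area formula for maps into a Euclidean space of another dimension -/

section AreaFormula

variable {E F : Type*} [NormedAddCommGroup E] [InnerProductSpace ℝ E] [FiniteDimensional ℝ E]
  [MeasurableSpace E] [BorelSpace E]
  [NormedAddCommGroup F] [InnerProductSpace ℝ F] [FiniteDimensional ℝ F]
  [MeasurableSpace F] [BorelSpace F]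

/-- If `f` is approximated by a linear map `A` on a measurable set up to `δ`, then its derivative
is almost everywhere within `δ` of `A`. -/
theorem approximatesLinearOn_ae_norm_fderiv_sub_le {f : E → F} {A : E →L[ℝ] F} {δ : ℝ≥0}
    {s : Set E} (hf : ApproximatesLinearOn f A s δ) (hs : MeasurableSet s) (f' : E → E →L[ℝ] F)
    (hf' : ∀ x ∈ s, HasFDerivWithinAt f (f' x) s x) :
    ∀ᵐ x ∂(volume : Measure E).restrict s, ‖f' x - A‖₊ ≤ δ := by
  filter_upwards [Besicovitch.ae_tendsto_measure_inter_div volume s, ae_restrict_mem hs]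
  intro x hx xs
  apply ContinuousLinearMap.opNorm_le_bound _ δ.2 fun z => ?_
  suffices H : ∀ ε, 0 < ε → ‖(f' x - A) z‖ ≤ (δ + ε) * (‖z‖ + ε) + ‖f' x - A‖ * ε by
    have :
      Tendsto (fun ε : ℝ => ((δ : ℝ) + ε) * (‖z‖ + ε) + ‖f' x - A‖ * ε) (𝓝[>] 0)
        (𝓝 ((δ + 0) * (‖z‖ + 0) + ‖f' x - A‖ * 0)) :=
      Tendsto.mono_left (Continuous.tendsto (by fun_prop) 0) nhdsWithin_le_nhds
    simp only [add_zero, mul_zero] at this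
    apply le_of_tendsto_of_tendsto tendsto_const_nhds this
    filter_upwards [self_mem_nhdsWithin]
    exact H
  intro ε εpos
  -- At a density point x, the set s meets every small ball x + r • B(z, ε), so the direction z can
  -- be tested up to an error ε.
  have B₁ : ∀ᶠ r in 𝓝[>] (0 : ℝ), (s ∩ ({x} + r • closedBall z ε)).Nonempty :=
    Measure.eventually_nonempty_inter_smul_of_density_one volume s x hx _
      measurableSet_closedBall (measure_closedBall_pos volume z εpos).ne'
  obtain ⟨ρ, ρpos, hρ⟩ :
    ∃ ρ > 0, ball x ρ ∩ s ⊆ {y : E | ‖f y - f x - (f' x) (y - x)‖ ≤ ε * ‖y - x‖} :=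
    mem_nhdsWithin_iff.1 ((hf' x xs).isLittleO.def εpos)
  have B₂ : ∀ᶠ r in 𝓝[>] (0 : ℝ), {x} + r • closedBall z ε ⊆ ball x ρ := by
    apply nhdsWithin_le_nhds
    exact eventually_singleton_add_smul_subset isBounded_closedBall (ball_mem_nhds x ρpos)
  obtain ⟨r, ⟨y, ⟨ys, hy⟩⟩, rρ, rpos⟩ :
    ∃ r : ℝ,
      (s ∩ ({x} + r • closedBall z ε)).Nonempty ∧ {x} + r • closedBall z ε ⊆ ball x ρ ∧ 0 < r :=
    (B₁.and (B₂.and self_mem_nhdsWithin)).exists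
  obtain ⟨a, az, ya⟩ : ∃ a, a ∈ closedBall z ε ∧ y = x + r • a := by
    simp only [mem_smul_set, image_add_left, mem_preimage, singleton_add] at hy
    rcases hy with ⟨a, az, ha⟩
    exact ⟨a, az, by simp only [ha, add_neg_cancel_left]⟩
  have norm_a : ‖a‖ ≤ ‖z‖ + ε :=
    calc
      ‖a‖ = ‖z + (a - z)‖ := by simp only [add_sub_cancel]
      _ ≤ ‖z‖ + ‖a - z‖ := norm_add_le _ _
      _ ≤ ‖z‖ + ε := by grw [mem_closedBall_iff_norm.1 az]
  have I : r * ‖(f' x - A) a‖ ≤ r * (δ + ε) * (‖z‖ + ε) :=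
    calc
      r * ‖(f' x - A) a‖ = ‖(f' x - A) (r • a)‖ := by
        simp only [map_smul, norm_smul, Real.norm_eq_abs, abs_of_nonneg rpos.le]
      _ = ‖f y - f x - A (y - x) - (f y - f x - (f' x) (y - x))‖ := by
        simp only [ya, add_sub_cancel_left, sub_sub_sub_cancel_left, FunLike.coe_sub,
          Pi.sub_apply, map_smul, smul_sub]
      _ ≤ ‖f y - f x - A (y - x)‖ + ‖f y - f x - (f' x) (y - x)‖ := norm_sub_le _ _
      _ ≤ δ * ‖y - x‖ + ε * ‖y - x‖ := (add_le_add (hf _ ys _ xs) (hρ ⟨rρ hy, ys⟩))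
      _ = r * (δ + ε) * ‖a‖ := by
        simp only [ya, add_sub_cancel_left, norm_smul, Real.norm_eq_abs, abs_of_nonneg rpos.le]
        ring
      _ ≤ r * (δ + ε) * (‖z‖ + ε) := by gcongr
  calc
    ‖(f' x - A) z‖ = ‖(f' x - A) a + (f' x - A) (z - a)‖ := by
      congr 1
      simp only [FunLike.coe_sub, map_sub, Pi.sub_apply]
      abel
    _ ≤ ‖(f' x - A) a‖ + ‖(f' x - A) (z - a)‖ := norm_add_le _ _
    _ ≤ (δ + ε) * (‖z‖ + ε) + ‖f' x - A‖ * ‖z - a‖ := by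
      apply add_le_add
      · rw [mul_assoc] at I; exact (mul_le_mul_iff_right₀ rpos).1 I
      · apply ContinuousLinearMap.le_opNorm
    _ ≤ (δ + ε) * (‖z‖ + ε) + ‖f' x - A‖ * ε := by
      rw [mem_closedBall_iff_norm'] at az
      gcongr

theorem euclideanHausdorffMeasure_image_le_of_lipschitzOnWith {X Y : Type*} [MetricSpace X]
    [MeasurableSpace X] [BorelSpace X] [MetricSpace Y] [MeasurableSpace Y] [BorelSpace Y]
    {f : X → Y} {s : Set X} {C : ℝ≥0} (hf : LipschitzOnWith C f s) (n : ℕ) :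
    μHE[n] (f '' s) ≤ (C : ℝ≥0∞) ^ n * μHE[n] s := by
  simp only [Measure.euclideanHausdorffMeasure_def, Measure.smul_apply, ENNReal.smul_def,
    smul_eq_mul]
  rw [mul_left_comm]
  gcongr
  simpa using hf.hausdorffMeasure_image_le (d := n) (by positivity)

/-- The bound forces `f` to be constant on the fibres of `g`, so `f` factors through `g` by a
Lipschitz map; neither map has to be injective. This allows a nonlinear map to be compared with its
linear approximation. -/
theorem euclideanHausdorffMeasure_image_le_of_dist_le {X Y Z : Type*} [MetricSpace X]
    [MeasurableSpace X] [BorelSpace X] [MetricSpace Y] [MeasurableSpace Y] [BorelSpace Y]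
    {f : Z → X} {g : Z → Y} {s : Set Z} {C : ℝ≥0}
    (h : ∀ x ∈ s, ∀ y ∈ s, dist (f x) (f y) ≤ C * dist (g x) (g y)) (n : ℕ) :
    μHE[n] (f '' s) ≤ (C : ℝ≥0∞) ^ n * μHE[n] (g '' s) := by
  rcases s.eq_empty_or_nonempty with rfl | ⟨z₀, hz₀⟩
  · simp
  have : Nonempty Z := ⟨z₀⟩
  set k : Y → Z := Function.invFunOn g s
  have hk : ∀ y ∈ g '' s, k y ∈ s ∧ g (k y) = y := fun y hy =>
    ⟨Function.invFunOn_mem hy, Function.invFunOn_eq hy⟩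
  have hL : LipschitzOnWith C (f ∘ k) (g '' s) := by
    refine LipschitzOnWith.of_dist_le_mul fun x hx y hy => ?_
    have := h _ (hk x hx).1 _ (hk y hy).1
    rwa [(hk x hx).2, (hk y hy).2] at this
  have himg : f '' s = (f ∘ k) '' (g '' s) := by
    ext w
    constructor
    · rintro ⟨x, hx, rfl⟩
      refine ⟨g x, mem_image_of_mem _ hx, ?_⟩
      have h1 := hk (g x) (mem_image_of_mem _ hx)
      have h2 := h _ h1.1 _ hx
      rw [h1.2, dist_self, mul_zero] at h2
      exact dist_le_zero.1 h2
    · rintro ⟨y, hy, rfl⟩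
      exact mem_image_of_mem _ (hk y hy).1
  rw [himg]
  exact euclideanHausdorffMeasure_image_le_of_lipschitzOnWith hL n

/-- Compare the images of the unit ball, whose measures are the norm-determinants times the same
finite positive volume. -/
theorem normDet_le_of_norm_le {A B : E →L[ℝ] F} {C : ℝ≥0} (h : ∀ w, ‖A w‖ ≤ C * ‖B w‖) :
    ENNReal.ofReal A.toLinearMap.normDet ≤
      (C : ℝ≥0∞) ^ finrank ℝ E * ENNReal.ofReal B.toLinearMap.normDet := by
  have h0 := euclideanHausdorffMeasure_image_le_of_dist_le (f := A.toLinearMap)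
    (g := B.toLinearMap) (s := closedBall (0 : E) 1) (C := C)
    (fun x _ y _ => by simpa [dist_eq_norm, ← map_sub] using h (x - y)) (finrank ℝ E)
  rw [LinearMap.euclideanHausdorffMeasure_image_eq_normDet_mul_volume,
    LinearMap.euclideanHausdorffMeasure_image_eq_normDet_mul_volume, ← mul_assoc] at h0
  exact (ENNReal.mul_le_mul_iff_left
    (measure_closedBall_pos volume (0 : E) one_pos).ne'
    (isCompact_closedBall (0 : E) 1).measure_lt_top.ne).1 h0

theorem exists_pos_mul_norm_le_of_injective (A : E →L[ℝ] F) (hA : Function.Injective A) :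
    ∃ c : ℝ≥0, 0 < c ∧ ∀ w, c * ‖w‖ ≤ ‖A w‖ := by
  obtain ⟨K, hK, h⟩ := A.toLinearMap.exists_antilipschitzWith (LinearMap.ker_eq_bot.2 hA)
  refine ⟨K⁻¹, inv_pos.2 hK, fun w => ?_⟩
  have := h.le_mul_dist w 0
  simp only [dist_zero_right, map_zero] at this
  rw [NNReal.coe_inv, inv_mul_le_iff₀ (by exact_mod_cast hK)]
  simpa using this

/-- The two-sided estimate behind the area formula on a piece where `f` is nearly linear. -/
theorem area_estimate_of_approximatesLinearOn {f : E → F} {A : E →L[ℝ] F} {s : Set E} {c ε : ℝ≥0}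
    (hε : ε < 1) (hA : ∀ w, c * ‖w‖ ≤ ‖A w‖) (hf : ApproximatesLinearOn f A s (ε * c))
    (hs : MeasurableSet s) (f' : E → E →L[ℝ] F) (hf' : ∀ x ∈ s, HasFDerivWithinAt f (f' x) s x) :
    μHE[finrank ℝ E] (f '' s) ≤ (((1 + ε) / (1 - ε) : ℝ≥0) : ℝ≥0∞) ^ finrank ℝ E *
        ∫⁻ x in s, ENNReal.ofReal (f' x).toLinearMap.normDet ∧
    ∫⁻ x in s, ENNReal.ofReal (f' x).toLinearMap.normDet ≤
      (((1 + ε) / (1 - ε) : ℝ≥0) : ℝ≥0∞) ^ finrank ℝ E * μHE[finrank ℝ E] (f '' s) := by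
  set n := finrank ℝ E
  set J := ENNReal.ofReal A.toLinearMap.normDet
  have h1ε : (0 : ℝ) < 1 - ε := by
    have : (ε : ℝ) < 1 := by exact_mod_cast hε
    linarith
  have hsub : ((1 - ε : ℝ≥0) : ℝ) = 1 - ε := NNReal.coe_sub hε.le
  -- A relative error ε bounds each vector by the other; it serves both for increments of `f` and
  -- for values of `f'`, always against `A`.
  have key : ∀ (L w : F), ‖L - w‖ ≤ ε * ‖w‖ →
      ‖L‖ ≤ (1 + ε : ℝ≥0) * ‖w‖ ∧ ‖w‖ ≤ ((1 - ε)⁻¹ : ℝ≥0) * ‖L‖ := by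
    intro L w h
    constructor
    · have := norm_le_insert' L w
      push_cast
      linarith
    · have h2 := norm_le_insert L w
      rw [NNReal.coe_inv, hsub, inv_mul_eq_div, le_div_iff₀ h1ε]
      linarith
  -- The lower bound `c` of `A` converts the tolerance `ε * c` into an error relative to `‖A (x -
  -- y)‖`.
  have hd : ∀ x ∈ s, ∀ y ∈ s, ‖(f x - f y) - A (x - y)‖ ≤ ε * ‖A (x - y)‖ := by
    intro x hx y hy
    refine (hf x hx y hy).trans ?_
    push_cast
    rw [mul_assoc]
    gcongr
    exact hA _
  have hv : μHE[n] (A '' s) = J * volume s :=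
    A.toLinearMap.euclideanHausdorffMeasure_image_eq_normDet_mul_volume s
  have up : μHE[n] (f '' s) ≤ ((1 + ε : ℝ≥0) : ℝ≥0∞) ^ n * (J * volume s) := by
    rw [← hv]
    refine euclideanHausdorffMeasure_image_le_of_dist_le (fun x hx y hy => ?_) n
    simpa [dist_eq_norm, ← map_sub] using (key _ _ (hd x hx y hy)).1
  have low : J * volume s ≤ (((1 - ε)⁻¹ : ℝ≥0) : ℝ≥0∞) ^ n * μHE[n] (f '' s) := by
    rw [← hv]
    refine euclideanHausdorffMeasure_image_le_of_dist_le (fun x hx y hy => ?_) n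
    simpa only [dist_eq_norm, ← map_sub] using (key _ _ (hd x hx y hy)).2
  have hae := approximatesLinearOn_ae_norm_fderiv_sub_le hf hs f' hf'
  have hae' : ∀ᵐ x ∂(volume : Measure E).restrict s, ∀ w, ‖f' x w - A w‖ ≤ ε * ‖A w‖ := by
    filter_upwards [hae] with x hx w
    calc ‖f' x w - A w‖ = ‖(f' x - A) w‖ := by simp
      _ ≤ ‖f' x - A‖ * ‖w‖ := ContinuousLinearMap.le_opNorm _ _
      _ ≤ (ε * c : ℝ≥0) * ‖w‖ := by gcongr; exact_mod_cast hx
      _ = ε * (c * ‖w‖) := by push_cast; ring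
      _ ≤ ε * ‖A w‖ := by gcongr; exact hA w
  have up' : ∫⁻ x in s, ENNReal.ofReal (f' x).toLinearMap.normDet ≤
      ((1 + ε : ℝ≥0) : ℝ≥0∞) ^ n * (J * volume s) := by
    rw [← mul_assoc, ← setLIntegral_const]
    refine lintegral_mono_ae ?_
    filter_upwards [hae'] with x hx
    exact normDet_le_of_norm_le fun w => (key _ _ (hx w)).1
  have low' : J * volume s ≤ (((1 - ε)⁻¹ : ℝ≥0) : ℝ≥0∞) ^ n *
      ∫⁻ x in s, ENNReal.ofReal (f' x).toLinearMap.normDet := by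
    rw [← setLIntegral_const, ← lintegral_const_mul' _ _ (by finiteness)]
    refine lintegral_mono_ae ?_
    filter_upwards [hae'] with x hx
    exact normDet_le_of_norm_le fun w => (key _ _ (hx w)).2
  have hq : (((1 + ε) / (1 - ε) : ℝ≥0) : ℝ≥0∞) ^ n =
      ((1 + ε : ℝ≥0) : ℝ≥0∞) ^ n * (((1 - ε)⁻¹ : ℝ≥0) : ℝ≥0∞) ^ n := by
    rw [div_eq_mul_inv, ENNReal.coe_mul, mul_pow]
  rw [hq]
  constructor
  · refine up.trans ?_
    rw [mul_assoc]
    gcongr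
  · refine up'.trans ?_
    rw [mul_assoc]
    gcongr

/-- The **area formula** for injective differentiable maps with injective derivative between
Euclidean spaces of possibly different dimensions. -/
theorem lintegral_normDet_fderiv_eq_euclideanHausdorffMeasure_image {f : E → F} {s : Set E}
    (hs : MeasurableSet s) {f' : E → E →L[ℝ] F} (hf' : ∀ x ∈ s, HasFDerivWithinAt f (f' x) s x)
    (hf'i : ∀ x ∈ s, Function.Injective (f' x)) (hf : InjOn f s) :
    ∫⁻ x in s, ENNReal.ofReal (f' x).toLinearMap.normDet = μHE[finrank ℝ E] (f '' s) := by
  set n := finrank ℝ E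
  have main : ∀ ε : ℝ≥0, 0 < ε → ε < 1 →
      μHE[n] (f '' s) ≤ (((1 + ε) / (1 - ε) : ℝ≥0) : ℝ≥0∞) ^ n *
        ∫⁻ x in s, ENNReal.ofReal (f' x).toLinearMap.normDet ∧
      ∫⁻ x in s, ENNReal.ofReal (f' x).toLinearMap.normDet ≤
        (((1 + ε) / (1 - ε) : ℝ≥0) : ℝ≥0∞) ^ n * μHE[n] (f '' s) := by
    intro ε hε hε1
    rcases s.eq_empty_or_nonempty with rfl | hne
    · simp
    -- The partition needs a positive tolerance for every linear map; the value 1 for non-injective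
    -- maps is never used, since each `A i` is some `f' y`.
    have hex : ∀ A : E →L[ℝ] F, ∃ c : ℝ≥0, 0 < c ∧
        (Function.Injective A → ∀ w, c * ‖w‖ ≤ ‖A w‖) := by
      intro A
      by_cases hA : Function.Injective A
      · obtain ⟨c, hc, h⟩ := exists_pos_mul_norm_le_of_injective A hA
        exact ⟨c, hc, fun _ => h⟩
      · exact ⟨1, one_pos, fun h => absurd h hA⟩
    choose c hc hcA using hex
    obtain ⟨t, A, tdisj, tmeas, tcov, tapp, hA⟩ :=
      exists_partition_approximatesLinearOn_of_hasFDerivWithinAt f s f' hf' (fun A => ε * c A)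
        (fun A => (mul_pos hε (hc A)).ne')
    have hcov : s = ⋃ i, s ∩ t i := by rw [← inter_iUnion, inter_eq_left.2 tcov]
    have hm : ∀ i, MeasurableSet (s ∩ t i) := fun i => hs.inter (tmeas i)
    have hpd : Pairwise (Function.onFun Disjoint fun i => s ∩ t i) := fun i j hij =>
      (tdisj hij).mono inter_subset_right inter_subset_right
    have hAi : ∀ i, Function.Injective (A i) := fun i => by
      obtain ⟨y, hy, hyA⟩ := hA hne i
      rw [hyA]
      exact hf'i y hy
    have est := fun i => area_estimate_of_approximatesLinearOn hε1 (hcA (A i) (hAi i)) (tapp i)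
      (hm i) f' (fun x hx => (hf' x hx.1).mono inter_subset_left)
    have hint : ∫⁻ x in s, ENNReal.ofReal (f' x).toLinearMap.normDet =
        ∑' i, ∫⁻ x in s ∩ t i, ENNReal.ofReal (f' x).toLinearMap.normDet := by
      conv_lhs => rw [hcov]
      exact lintegral_iUnion hm hpd _
    have himg : μHE[n] (f '' s) = ∑' i, μHE[n] (f '' (s ∩ t i)) := by
      conv_lhs => rw [hcov, image_iUnion]
      refine measure_iUnion (fun i j hij => ?_) fun i => ?_
      · refine disjoint_left.2 ?_
        rintro _ ⟨x, hx, rfl⟩ ⟨y, hy, hxy⟩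
        obtain rfl := hf hy.1 hx.1 hxy
        exact disjoint_left.1 (hpd hij) hx hy
      · refine (hm i).image_of_continuousOn_injOn (fun x hx => ?_) (hf.mono inter_subset_left)
        exact ((hf' x hx.1).mono inter_subset_left).continuousWithinAt
    rw [hint, himg, ← ENNReal.tsum_mul_left, ← ENNReal.tsum_mul_left]
    exact ⟨ENNReal.tsum_le_tsum fun i => (est i).1, ENNReal.tsum_le_tsum fun i => (est i).2⟩
  have hlim : Tendsto (fun ε : ℝ≥0 => (((1 + ε) / (1 - ε) : ℝ≥0) : ℝ≥0∞) ^ n) (𝓝[>] 0)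
      (𝓝 1) := by
    have h1 : Tendsto (fun ε : ℝ≥0 => (1 + ε) / (1 - ε)) (𝓝[>] 0) (𝓝 ((1 + 0) / (1 - 0))) := by
      refine Tendsto.div ?_ ?_ (by simp)
      · exact Tendsto.mono_left (Continuous.tendsto (by fun_prop) 0) nhdsWithin_le_nhds
      · exact Tendsto.mono_left (Continuous.tendsto (by fun_prop) 0) nhdsWithin_le_nhds
    simp only [add_zero, tsub_zero, div_one] at h1
    simpa using ENNReal.Tendsto.pow (n := n) (ENNReal.tendsto_coe.2 h1)
  have hev : ∀ᶠ ε : ℝ≥0 in 𝓝[>] 0, 0 < ε ∧ ε < 1 := Ioo_mem_nhdsGT one_pos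
  have limc : ∀ a : ℝ≥0∞, Tendsto
      (fun ε : ℝ≥0 => (((1 + ε) / (1 - ε) : ℝ≥0) : ℝ≥0∞) ^ n * a) (𝓝[>] 0) (𝓝 a) := by
    intro a
    simpa using ENNReal.Tendsto.mul_const hlim (Or.inl one_ne_zero) (b := a)
  refine le_antisymm (ge_of_tendsto (limc _) ?_) (ge_of_tendsto (limc _) ?_)
  · filter_upwards [hev] with ε h using (main ε h.1 h.2).2
  · filter_upwards [hev] with ε h using (main ε h.1 h.2).1

/-- The norm-determinant is the square root of det(L* L). Continuity makes the Jacobian measurable.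
-/
theorem continuous_normDet : Continuous fun L : E →L[ℝ] F => L.toLinearMap.normDet := by
  have : (fun L : E →L[ℝ] F => L.toLinearMap.normDet) =
      fun L => Real.sqrt (L.adjoint ∘L L).det := by
    ext L
    rw [← L.normDet_sq]
    simp [Real.sqrt_sq (LinearMap.normDet_nonneg _)]
  rw [this]
  refine Real.continuous_sqrt.comp (ContinuousLinearMap.continuous_det.comp ?_)
  exact (ContinuousLinearMap.adjoint.continuous).clm_comp continuous_id

/-- The **area formula** for integrals over the image of an injective differentiable map. -/
theorem lintegral_image_eq_lintegral_normDet_mul {f : E → F} {s : Set E}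
    (hs : MeasurableSet s) {f' : E → E →L[ℝ] F} (hf' : ∀ x ∈ s, HasFDerivWithinAt f (f' x) s x)
    (hf'm : AEMeasurable f' (volume.restrict s))
    (hf'i : ∀ x ∈ s, Function.Injective (f' x)) (hf : InjOn f s) (g : F → ℝ≥0∞) :
    ∫⁻ x in f '' s, g x ∂μHE[finrank ℝ E] =
      ∫⁻ x in s, ENNReal.ofReal (f' x).toLinearMap.normDet * g (f x) := by
  have hc : ContinuousOn f s := fun x hx => (hf' x hx).continuousWithinAt
  have hJ : AEMeasurable (fun x => ENNReal.ofReal (f' x).toLinearMap.normDet)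
      (volume.restrict s) :=
    (ENNReal.measurable_ofReal.comp continuous_normDet.measurable).comp_aemeasurable hf'm
  -- The Jacobian measure on `s` pushes forward to the Hausdorff measure on the image. As `f`
  -- restricted to `s` is a measurable embedding, `g` need not be measurable.
  have hmap : Measure.map (s.domRestrict f) (Measure.comap (↑)
      ((volume : Measure E).withDensity fun x => ENNReal.ofReal (f' x).toLinearMap.normDet)) =
      (μHE[finrank ℝ E]).restrict (f '' s) := by
    have hemb := hc.measurableEmbedding hs hf
    refine Measure.ext fun t ht => ?_
    rw [hemb.map_apply, (MeasurableEmbedding.subtype_coe hs).comap_apply,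
      Measure.restrict_apply ht]
    have h1 : (Subtype.val '' (s.domRestrict f ⁻¹' t) : Set E) = s ∩ f ⁻¹' t := by
      ext x
      simp [Set.domRestrict_apply, and_comm]
    have hm : MeasurableSet (s ∩ f ⁻¹' t) := by
      rw [← h1]
      exact (MeasurableEmbedding.subtype_coe hs).measurableSet_image.2
        (hemb.measurable ht)
    rw [h1, withDensity_apply _ hm,
      lintegral_normDet_fderiv_eq_euclideanHausdorffMeasure_image hm
        (fun x hx => (hf' x hx.1).mono inter_subset_left) (fun x hx => hf'i x hx.1)
        (hf.mono inter_subset_left), image_inter_preimage, inter_comm]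
  rw [← hmap, (hc.measurableEmbedding hs hf).lintegral_map]
  simp only [Set.domRestrict_apply, ← Function.comp_apply (f := g)]
  rw [← (MeasurableEmbedding.subtype_coe hs).lintegral_map, map_comap_subtype_coe hs,
    setLIntegral_withDensity_eq_setLIntegral_mul_non_measurable₀ _ hJ _ hs]
  · simp only [Pi.mul_apply, Function.comp_apply]
  · simp only [eventually_true, ENNReal.ofReal_lt_top]

end AreaFormula

/-! ### Hyperplane frames and codimension-one Jacobians -/

section Frame

variable {E F : Type*} [NormedAddCommGroup E] [InnerProductSpace ℝ E] [FiniteDimensional ℝ E]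
  [NormedAddCommGroup F] [InnerProductSpace ℝ F] [FiniteDimensional ℝ F]

/-- An isometric identification of `E` with the hyperplane of `F` orthogonal to a unit vector. -/
structure HyperplaneFrame (E F : Type*) [NormedAddCommGroup E] [InnerProductSpace ℝ E]
    [NormedAddCommGroup F] [InnerProductSpace ℝ F] where
  normal : F
  incl : E →ₗᵢ[ℝ] F
  norm_normal : ‖normal‖ = 1
  inner_normal_incl : ∀ z, ⟪normal, incl z⟫ = 0
  finrank_eq : finrank ℝ F = finrank ℝ E + 1

theorem exists_hyperplaneFrame (hd : finrank ℝ F = finrank ℝ E + 1) {e : F} (he : ‖e‖ = 1) :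
    ∃ H : HyperplaneFrame E F, H.normal = e := by
  have hne : e ≠ 0 := by
    rintro rfl
    simp at he
  have : Fact (finrank ℝ F = finrank ℝ E + 1) := ⟨hd⟩
  have hr : finrank ℝ (ℝ ∙ e)ᗮ = finrank ℝ E := Submodule.finrank_orthogonal_span_singleton hne
  let φ : E ≃ₗᵢ[ℝ] (ℝ ∙ e)ᗮ := 
    (stdOrthonormalBasis ℝ E).equiv (stdOrthonormalBasis ℝ (ℝ ∙ e)ᗮ) (finCongr hr.symm)
  refine ⟨⟨e, (ℝ ∙ e)ᗮ.subtypeₗᵢ.comp φ.toLinearIsometry, he, fun z => ?_, hd⟩, rfl⟩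
  exact Submodule.mem_orthogonal_singleton_iff_inner_right.1 (φ z).2

namespace HyperplaneFrame

variable (H : HyperplaneFrame E F)

/-- The orthogonal projection onto the hyperplane, read in `E`. -/
noncomputable def coord : F →L[ℝ] E := H.incl.toContinuousLinearMap.adjoint

/-- The parametrization of the affine hyperplane at height one. -/
def chart (z : E) : F := H.normal + H.incl z

theorem inner_normal_normal : ⟪H.normal, H.normal⟫ = 1 := by
  rw [real_inner_self_eq_norm_sq, H.norm_normal, one_pow]

theorem inner_normal_chart (z : E) : ⟪H.normal, H.chart z⟫ = 1 := by
  rw [chart, inner_add_right, H.inner_normal_normal, H.inner_normal_incl, add_zero]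

theorem inner_coord (y : F) (z : E) : ⟪H.coord y, z⟫ = ⟪y, H.incl z⟫ := by
  simp [coord, ContinuousLinearMap.adjoint_inner_left]

theorem coord_incl (z : E) : H.coord (H.incl z) = z := by
  refine ext_inner_right ℝ fun w => ?_
  rw [inner_coord, H.incl.inner_map_map]

theorem coord_normal : H.coord H.normal = 0 := by
  refine ext_inner_right ℝ fun w => ?_
  rw [inner_coord, H.inner_normal_incl, inner_zero_left]

theorem coord_chart (z : E) : H.coord (H.chart z) = z := by
  rw [chart, map_add, coord_normal, coord_incl, zero_add]

/-- The orthonormal basis of `F` made of the normal and an orthonormal basis of the hyperplane. -/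
noncomputable def basis : OrthonormalBasis (Unit ⊕ Fin (finrank ℝ E)) ℝ F :=
  have ho : Orthonormal ℝ (Sum.elim (fun _ : Unit => H.normal)
      fun i => H.incl (stdOrthonormalBasis ℝ E i)) := by
    rw [orthonormal_iff_ite]
    rintro (i | i) (j | j)
    · simpa using H.inner_normal_normal
    · simpa using H.inner_normal_incl _
    · simpa [real_inner_comm] using H.inner_normal_incl _
    · simpa using orthonormal_iff_ite.1 (stdOrthonormalBasis ℝ E).orthonormal i j
  OrthonormalBasis.mk ho (by
    have := ho.linearIndependent.span_eq_top_of_card_eq_finrank' (by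
      rw [H.finrank_eq]; simp [add_comm])
    rw [this])

theorem basis_inl (i : Unit) : H.basis (Sum.inl i) = H.normal := by simp [basis]

theorem basis_inr (i : Fin (finrank ℝ E)) :
    H.basis (Sum.inr i) = H.incl (stdOrthonormalBasis ℝ E i) := by simp [basis]

theorem incl_coord (y : F) : H.incl (H.coord y) = y - ⟪H.normal, y⟫ • H.normal := by
  refine InnerProductSpace.ext_inner_left_basis H.basis.toBasis fun i => ?_
  rw [OrthonormalBasis.coe_toBasis, inner_sub_right, inner_smul_right]
  rcases i with i | i
  · rw [basis_inl, H.inner_normal_incl, H.inner_normal_normal]; ring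
  · rw [basis_inr, H.incl.inner_map_map, real_inner_comm, inner_coord, real_inner_comm,
      real_inner_comm H.normal, H.inner_normal_incl]
    ring

theorem chart_coord_smul {y : F} (hy : ⟪H.normal, y⟫ ≠ 0) :
    ⟪H.normal, y⟫ • H.chart (⟪H.normal, y⟫⁻¹ • H.coord y) = y := by
  rw [chart, map_smul, smul_add, smul_smul, mul_inv_cancel₀ hy, one_smul, incl_coord]
  abel

theorem one_le_norm_chart (z : E) : 1 ≤ ‖H.chart z‖ := by
  have := real_inner_le_norm H.normal (H.chart z)
  rwa [inner_normal_chart, H.norm_normal, one_mul] at this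

theorem norm_chart_pos (z : E) : 0 < ‖H.chart z‖ := one_pos.trans_le (H.one_le_norm_chart z)

theorem continuous_chart : Continuous H.chart :=
  continuous_const.add H.incl.continuous

theorem hasFDerivAt_chart (z : E) :
    HasFDerivAt H.chart H.incl.toContinuousLinearMap z :=
  (H.incl.toContinuousLinearMap.hasFDerivAt).const_add _

theorem exists_eq_of_orthogonal {u : F} (hu : ∀ z, ⟪u, H.incl z⟫ = 0) :
    u = ⟪H.normal, u⟫ • H.normal := by
  have h0 : H.coord u = 0 := ext_inner_right ℝ fun w => by rw [inner_coord, hu, inner_zero_left]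
  have := H.incl_coord u
  rw [h0, map_zero] at this
  exact (sub_eq_zero.1 this.symm)

/-- The endomorphism of `F` extending a linear map on the hyperplane by a given value at the
normal. -/
noncomputable def extend (L : E →ₗ[ℝ] F) (q : F) : F →ₗ[ℝ] F :=
  L ∘ₗ H.coord.toLinearMap + (innerₛₗ ℝ H.normal).smulRight q

theorem extend_apply (L : E →ₗ[ℝ] F) (q y : F) :
    H.extend L q y = L (H.coord y) + ⟪H.normal, y⟫ • q := by
  simp [extend]

theorem extend_basis_inl (L : E →ₗ[ℝ] F) (q : F) (i : Unit) :
    H.extend L q (H.basis (Sum.inl i)) = q := by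
  rw [basis_inl, extend_apply, coord_normal, inner_normal_normal, map_zero, zero_add, one_smul]

theorem extend_basis_inr (L : E →ₗ[ℝ] F) (q : F) (i : Fin (finrank ℝ E)) :
    H.extend L q (H.basis (Sum.inr i)) = L (stdOrthonormalBasis ℝ E i) := by
  rw [basis_inr, extend_apply, coord_incl, inner_normal_incl, zero_smul, add_zero]

end HyperplaneFrame

/-- This is det(Mᵀ N), whose entries in an orthonormal basis are the inner products of columns. -/
theorem det_mul_det_eq_det_inner {ι : Type*} [Fintype ι] [DecidableEq ι]
    (b : OrthonormalBasis ι ℝ F) (M N : F →ₗ[ℝ] F) :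
    M.det * N.det = (Matrix.of fun i j => ⟪M (b i), N (b j)⟫).det := by
  rw [← LinearMap.det_toMatrix b.toBasis M, ← LinearMap.det_toMatrix b.toBasis N,
    ← Matrix.det_transpose, ← Matrix.det_mul]
  congr 1
  ext i j
  simp only [Matrix.mul_apply, Matrix.transpose_apply, LinearMap.toMatrix_apply,
    OrthonormalBasis.coe_toBasis, OrthonormalBasis.coe_toBasis_repr_apply,
    OrthonormalBasis.repr_apply_apply, Matrix.of_apply]
  rw [← b.sum_inner_mul_inner]
  exact Finset.sum_congr rfl fun k _ => by rw [real_inner_comm]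

namespace HyperplaneFrame

variable (H : HyperplaneFrame E F)

/-- As `u` is orthogonal to the image of `L`, the matrix of inner products is block triangular, with
diagonal blocks ⟨u, q⟩ and the Gram matrix of `L`. -/
theorem det_extend_mul_det_extend {L : E →ₗ[ℝ] F} {u : F} (hu : ∀ w, ⟪u, L w⟫ = 0) (q : F) :
    (H.extend L u).det * (H.extend L q).det = ⟪u, q⟫ * L.normDet ^ 2 := by
  rw [det_mul_det_eq_det_inner H.basis]
  have hg := L.normDet_sq_eq_det_gram (stdOrthonormalBasis ℝ E)
  simp only [RCLike.ofReal_real_eq_id, id] at hg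
  rw [hg]
  have : (Matrix.of fun i j => ⟪H.extend L u (H.basis i), H.extend L q (H.basis j)⟫) =
      Matrix.fromBlocks (Matrix.of fun _ _ : Unit => ⟪u, q⟫) 0
        (Matrix.of fun i _ => ⟪L (stdOrthonormalBasis ℝ E i), q⟫)
        (Matrix.gram ℝ fun i => L (stdOrthonormalBasis ℝ E i)) := by
    ext (i | i) (j | j)
    · simp [extend_basis_inl]
    · simp [extend_basis_inl, extend_basis_inr, hu]
    · simp [extend_basis_inl, extend_basis_inr]
    · simp [extend_basis_inr, Matrix.gram_apply]
  rw [this, Matrix.det_fromBlocks_zero₁₂]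
  simp

/-- The norm-determinant of a linear immersion as a codimension-one minor: completing it by any
vector `q` multiplies it by the component of `q` along the unit normal of the image. -/
theorem abs_inner_mul_normDet {L : E →ₗ[ℝ] F} (hL : Function.Injective L) {u : F} (hu1 : ‖u‖ = 1)
    (hu : ∀ w, ⟪u, L w⟫ = 0) (q : F) :
    |⟪u, q⟫| * L.normDet = |(H.extend L q).det| := by
  -- The choice q = u identifies |det| of the extension by `u` with the norm-determinant, which can
  -- then be cancelled from the identity for general `q`.
  have h1 := H.det_extend_mul_det_extend hu u
  have h2 := H.det_extend_mul_det_extend hu q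
  rw [real_inner_self_eq_norm_sq, hu1, one_pow, one_mul, ← sq] at h1
  have h3 : |(H.extend L u).det| = L.normDet := by
    rw [← abs_of_nonneg L.normDet_nonneg]
    exact (sq_eq_sq_iff_abs_eq_abs _ _).1 h1
  have h4 := congrArg abs h2
  rw [abs_mul, abs_mul, h3, abs_of_nonneg (sq_nonneg L.normDet)] at h4
  have h5 : L.normDet ≠ 0 := fun h => L.normDet_eq_zero_iff_ker_ne_bot.1 h
    (LinearMap.ker_eq_bot.2 hL)
  refine mul_left_cancel₀ h5 ?_
  rw [h4]
  ring

/-- The term with `φ` only adds multiples of the last column, so it does not affect the determinant.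
In the factorization the scalar gives r^(n+1), the first transvection r⁻¹ and the second 1. -/
theorem det_extend_cone (z : E) {r : ℝ} (hr : r ≠ 0) (φ : E →ₗ[ℝ] ℝ) :
    (H.extend (r • H.incl.toLinearMap + φ.smulRight (H.chart z)) (H.chart z)).det =
      r ^ finrank ℝ E := by
  have h : H.extend (r • H.incl.toLinearMap + φ.smulRight (H.chart z)) (H.chart z) =
      (r • LinearMap.transvection (innerₛₗ ℝ H.normal) (r⁻¹ • H.chart z - H.normal)) ∘ₗ
        LinearMap.transvection (φ ∘ₗ H.coord.toLinearMap) H.normal := by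
    ext y
    simp only [extend_apply, LinearMap.comp_apply, LinearMap.smul_apply, LinearMap.add_apply,
      LinearMap.transvection.apply, LinearMap.smulRight_apply, innerₛₗ_apply_apply,
      ContinuousLinearMap.coe_coe, LinearIsometry.coe_toLinearMap, incl_coord, inner_add_right,
      inner_smul_right, inner_normal_normal, mul_one, smul_add, smul_sub, smul_smul, add_smul]
    match_scalars <;> field_simp <;> ring
  rw [h, LinearMap.det_comp, LinearMap.det_smul, LinearMap.transvection.det,
    LinearMap.transvection.det]
  simp only [innerₛₗ_apply_apply, inner_sub_right, inner_smul_right, inner_normal_chart,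
    inner_normal_normal, LinearMap.comp_apply, ContinuousLinearMap.coe_coe, coord_normal, map_zero,
    H.finrank_eq]
  field_simp
  ring

theorem cone_fderiv_injective (z : E) {r : ℝ} (hr : r ≠ 0) (φ : E →ₗ[ℝ] ℝ) :
    Function.Injective (r • H.incl.toLinearMap + φ.smulRight (H.chart z)) := by
  refine (injective_iff_map_eq_zero _).2 fun w hw => ?_
  simp only [LinearMap.add_apply, LinearMap.smul_apply, LinearMap.smulRight_apply,
    LinearIsometry.coe_toLinearMap] at hw
  have h1 := congrArg (fun y => ⟪H.normal, y⟫) hw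
  simp only [inner_add_right, inner_smul_right, inner_normal_incl, inner_normal_chart,
    inner_zero_right, mul_zero, zero_add, mul_one] at h1
  rw [h1, zero_smul, add_zero, smul_eq_zero, or_iff_right hr] at hw
  exact H.incl.injective (hw.trans (map_zero _).symm)

/-- The Jacobian of a radial map `z ↦ v + ρ z • ζ z` over the chart `ζ` of a hyperplane. -/
theorem abs_inner_mul_normDet_cone (z : E) {r : ℝ} (hr : 0 < r) (φ : E →ₗ[ℝ] ℝ) {u : F}
    (hu1 : ‖u‖ = 1)
    (hu : ∀ w, ⟪u, (r • H.incl.toLinearMap + φ.smulRight (H.chart z)) w⟫ = 0) :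
    |⟪u, H.chart z⟫| * (r • H.incl.toLinearMap + φ.smulRight (H.chart z)).normDet =
      r ^ finrank ℝ E := by
  rw [H.abs_inner_mul_normDet (H.cone_fderiv_injective z hr.ne' φ) hu1 hu,
    H.det_extend_cone z hr.ne' φ, abs_of_pos (by positivity)]

theorem hasFDerivAt_cone (v : F) {ρ : E → ℝ} {ρ' : E →L[ℝ] ℝ} {z : E} (hρ : HasFDerivAt ρ ρ' z) :
    HasFDerivAt (fun z => v + ρ z • H.chart z)
      (ρ z • H.incl.toContinuousLinearMap + ρ'.smulRight (H.chart z)) z :=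
  (hρ.smul (H.hasFDerivAt_chart z)).const_add v

variable [MeasurableSpace E] [BorelSpace E] [MeasurableSpace F] [BorelSpace F]

/-- The measure of a hyperplane section, computed by projecting along the frame normal. -/
theorem euclideanHausdorffMeasure_slice {s : F} (hs : ⟪s, H.normal⟫ ≠ 0) (c : ℝ) (Q : Set F) :
    μHE[finrank ℝ E] {y | y ∈ Q ∧ ⟪s, y⟫ = c} =
      ENNReal.ofReal (‖s‖ / |⟪s, H.normal⟫|) *
        volume {p : E | H.incl p + ((c - ⟪s, H.incl p⟫) / ⟪s, H.normal⟫) • H.normal ∈ Q} := by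
  set a := ⟪s, H.normal⟫ with ha
  -- The section is a graph over the hyperplane of the frame; `L` is the linear part of its
  -- parametrization.
  let φ : E →ₗ[ℝ] ℝ := -(a⁻¹ • ((innerₛₗ ℝ s) ∘ₗ H.incl.toLinearMap))
  let L : E →ₗ[ℝ] F := H.incl.toLinearMap + φ.smulRight H.normal
  have hφ : ∀ p, φ p = -(a⁻¹ * ⟪s, H.incl p⟫) := fun p => by simp [φ]
  have hL : ∀ p, L p = H.incl p + φ p • H.normal := fun p => by simp [L]
  have hs0 : s ≠ 0 := by
    rintro rfl
    simp [ha] at hs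
  have hns : 0 < ‖s‖ := norm_pos_iff.2 hs0
  have hLi : Function.Injective L := by
    refine (injective_iff_map_eq_zero _).2 fun w hw => ?_
    have := congrArg H.coord hw
    rwa [hL, map_add, map_smul, coord_incl, coord_normal, smul_zero, add_zero, map_zero] at this
  have hort : ∀ w, ⟪‖s‖⁻¹ • s, L w⟫ = 0 := by
    intro w
    rw [hL, real_inner_smul_left, inner_add_right, inner_smul_right, ← ha, hφ]
    field_simp
    ring
  -- Completed by the frame normal, `L` is a shear; its norm-determinant is therefore the inverse of
  -- the cosine between `s` and the normal.
  have hdet : (H.extend L H.normal).det = 1 := by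
    have : H.extend L H.normal = LinearMap.transvection (φ ∘ₗ H.coord.toLinearMap) H.normal := by
      ext y
      simp only [extend_apply, hL, incl_coord, LinearMap.transvection.apply, LinearMap.comp_apply,
        ContinuousLinearMap.coe_coe]
      abel
    rw [this, LinearMap.transvection.det]
    simp [coord_normal]
  have hJ : L.normDet = ‖s‖ / |a| := by
    have h1 := H.abs_inner_mul_normDet hLi (u := ‖s‖⁻¹ • s)
      (by rw [norm_smul, norm_inv, norm_norm, inv_mul_cancel₀ hns.ne']) hort H.normal
    rw [hdet, real_inner_smul_left, ← ha, abs_mul, abs_inv, abs_norm, abs_one] at h1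
    have ha' : |a| ≠ 0 := abs_ne_zero.2 hs
    field_simp at h1 ⊢
    linarith
  have himg : {y | y ∈ Q ∧ ⟪s, y⟫ = c} = (fun y => (c / a) • H.normal +ᵥ y) '' (L ''
      {p : E | H.incl p + ((c - ⟪s, H.incl p⟫) / a) • H.normal ∈ Q}) := by
    have hkey : ∀ p, (c / a) • H.normal + L p =
        H.incl p + ((c - ⟪s, H.incl p⟫) / a) • H.normal := by
      intro p
      rw [hL, hφ, sub_div, sub_smul, neg_smul, div_eq_inv_mul ⟪s, H.incl p⟫]
      abel
    ext y
    simp only [mem_ofPred_eq, image_image, vadd_eq_add, hkey, mem_image]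
    constructor
    · rintro ⟨hy, hc⟩
      have : H.incl (H.coord y) + ((c - ⟪s, H.incl (H.coord y)⟫) / a) • H.normal = y := by
        rw [incl_coord, inner_sub_right, inner_smul_right, hc, ← ha, sub_sub_cancel,
          mul_div_cancel_right₀ _ hs, sub_add_cancel]
      exact ⟨H.coord y, by rwa [this], this⟩
    · rintro ⟨p, hp, rfl⟩
      refine ⟨hp, ?_⟩
      rw [inner_add_right, inner_smul_right, ← ha, div_mul_cancel₀ _ hs]
      ring
  rw [himg, (isometry_vadd F ((c / a) • H.normal)).euclideanHausdorffMeasure_image,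
    L.euclideanHausdorffMeasure_image_eq_normDet_mul_volume, hJ]

end HyperplaneFrame

end Frame

/-! ### Rademacher's theorem and null sets for locally Lipschitz maps -/

section LocallyLipschitz

variable {E F : Type*} [NormedAddCommGroup E] [InnerProductSpace ℝ E] [FiniteDimensional ℝ E]
  [MeasurableSpace E] [BorelSpace E]
  [NormedAddCommGroup F] [InnerProductSpace ℝ F] [FiniteDimensional ℝ F]
  [MeasurableSpace F] [BorelSpace F]

theorem ae_differentiableAt_of_locallyLipschitzOn {f : E → F} {U : Set E} (hU : IsOpen U)
    (hf : LocallyLipschitzOn U f) : ∀ᵐ x, x ∈ U → DifferentiableAt ℝ f x := by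
  have hex : ∀ x, ∃ t : Set E, x ∈ U → t ∈ 𝓝 x ∧ ∃ K, LipschitzOnWith K f t := by
    intro x
    by_cases hx : x ∈ U
    · obtain ⟨K, t, ht, hK⟩ := hf hx
      rw [hU.nhdsWithin_eq hx] at ht
      exact ⟨t, fun _ => ⟨ht, K, hK⟩⟩
    · exact ⟨∅, fun h => absurd h hx⟩
  choose t ht using hex
  obtain ⟨c, hcU, hc, hcov⟩ := TopologicalSpace.countable_cover_nhdsWithin (s := U)
    (f := fun x => interior (t x)) fun x hx =>
      mem_nhdsWithin_of_mem_nhds (interior_mem_nhds.2 (ht x hx).1)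
  have hall : ∀ᵐ x, ∀ y ∈ c, x ∈ interior (t y) → DifferentiableAt ℝ f x := by
    refine (ae_ball_iff hc).2 fun y hy => ?_
    obtain ⟨K, hK⟩ := (ht y (hcU hy)).2
    filter_upwards [(hK.mono interior_subset).ae_differentiableWithinAt_of_mem] with x hx hxt
    exact (hx hxt).differentiableAt (isOpen_interior.mem_nhds hxt)
  filter_upwards [hall] with x hx hxU
  obtain ⟨y, hy, hxy⟩ := mem_iUnion₂.1 (hcov hxU)
  exact hx y hy hxy

theorem euclideanHausdorffMeasure_image_eq_zero_of_locallyLipschitzOn {f : E → F} {U N : Set E}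
    (hf : LocallyLipschitzOn U f) (hNU : N ⊆ U) (hN : volume N = 0) :
    μHE[finrank ℝ E] (f '' N) = 0 := by
  have hex : ∀ x, ∃ t : Set E, x ∈ U → t ∈ 𝓝[U] x ∧ ∃ K, LipschitzOnWith K f t := by
    intro x
    by_cases hx : x ∈ U
    · obtain ⟨K, t, ht, hK⟩ := hf hx
      exact ⟨t, fun _ => ⟨ht, K, hK⟩⟩
    · exact ⟨∅, fun h => absurd h hx⟩
  choose t ht using hex
  obtain ⟨c, hcU, hc, hcov⟩ := TopologicalSpace.countable_cover_nhdsWithin (s := U)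
    (f := t) fun x hx => (ht x hx).1
  have hsub : f '' N ⊆ ⋃ y ∈ c, f '' (N ∩ t y) := by
    rintro _ ⟨x, hx, rfl⟩
    obtain ⟨y, hy, hxy⟩ := mem_iUnion₂.1 (hcov (hNU hx))
    exact mem_iUnion₂.2 ⟨y, hy, mem_image_of_mem _ ⟨hx, hxy⟩⟩
  refine measure_mono_null hsub ((measure_biUnion_null_iff hc).2 fun y hy => ?_)
  obtain ⟨K, hK⟩ := (ht y (hcU hy)).2
  have := euclideanHausdorffMeasure_image_le_of_lipschitzOnWith
    (hK.mono (inter_subset_right (s := N))) (finrank ℝ E)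
  rw [InnerProductSpace.euclideanHausdorffMeasure_eq_volume,
    measure_mono_null inter_subset_left hN, mul_zero] at this
  exact le_antisymm this zero_le

end LocallyLipschitz

/-! ### Central projection of a convex body and its visible boundary -/

section Visible

variable {E F : Type*} [NormedAddCommGroup E] [InnerProductSpace ℝ E] [FiniteDimensional ℝ E]
  [NormedAddCommGroup F] [InnerProductSpace ℝ F] [FiniteDimensional ℝ F]

/-- The part of the boundary of `G` where the ray from `v` enters the interior of `G`. -/
def visiblePart (G : Set F) (v : F) : Set F :=
  {x | x ∈ frontier G ∧ ∃ s : ℝ, 0 < s ∧ x + s • (x - v) ∈ interior G}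

namespace HyperplaneFrame

variable (H : HyperplaneFrame E F)

/-- The central projection of `A` from `v` to the hyperplane of the frame. -/
def shadow (A : Set F) (v : F) : Set E := {z | ∃ t : ℝ, v + t • H.chart z ∈ A}

/-- The parameter at which the ray from `v` in direction `H.chart z` first meets `G`. -/
noncomputable def radius (G : Set F) (v : F) (z : E) : ℝ := sInf {t : ℝ | v + t • H.chart z ∈ G}

/-- The point at which the ray from `v` in direction `H.chart z` first meets `G`. -/
noncomputable def entry (G : Set F) (v : F) (z : E) : F := v + H.radius G v z • H.chart z

/-- `G` is a compact convex set lying strictly above `v` with respect to the frame. -/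
structure Sees (G : Set F) (v : F) : Prop where
  isCompact : IsCompact G
  convex : Convex ℝ G
  pos : ∃ δ : ℝ, 0 < δ ∧ ∀ x ∈ G, δ ≤ ⟪H.normal, x - v⟫

variable {H} {G : Set F} {v : F}

theorem inner_normal_smul_chart (H : HyperplaneFrame E F) (v : F) (t : ℝ) (z : E) :
    ⟪H.normal, v + t • H.chart z - v⟫ = t := by
  rw [add_sub_cancel_left, inner_smul_right, inner_normal_chart, mul_one]

theorem add_smul_chart_injective {v : F} {t t' : ℝ} {z z' : E} (ht : t ≠ 0)
    (h : v + t • H.chart z = v + t' • H.chart z') : t = t' ∧ z = z' := by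
  have h1 : t = t' := by
    rw [← inner_normal_smul_chart H v t z, h, inner_normal_smul_chart]
  subst h1
  refine ⟨rfl, ?_⟩
  have h2 := smul_right_injective F ht (add_left_cancel h)
  rw [← H.coord_chart z, h2, H.coord_chart]

theorem exists_eq_add_smul_chart (H : HyperplaneFrame E F) {v x : F}
    (hx : 0 < ⟪H.normal, x - v⟫) :
    x = v + ⟪H.normal, x - v⟫ • H.chart (⟪H.normal, x - v⟫⁻¹ • H.coord (x - v)) := by
  rw [H.chart_coord_smul hx.ne', add_sub_cancel]

namespace Sees

theorem pos_of_mem (h : H.Sees G v) {t : ℝ} {z : E} (hz : v + t • H.chart z ∈ G) : 0 < t := by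
  obtain ⟨δ, hδ, hb⟩ := h.pos
  have := hb _ hz
  rw [inner_normal_smul_chart] at this
  exact hδ.trans_le this

theorem bddBelow (h : H.Sees G v) (z : E) : BddBelow {t : ℝ | v + t • H.chart z ∈ G} :=
  ⟨0, fun _ ht => (h.pos_of_mem ht).le⟩

theorem radius_le (h : H.Sees G v) {t : ℝ} {z : E} (hz : v + t • H.chart z ∈ G) :
    H.radius G v z ≤ t := csInf_le (h.bddBelow z) hz

theorem entry_mem (h : H.Sees G v) {z : E} (hz : z ∈ H.shadow G v) : H.entry G v z ∈ G := by
  have hc : IsClosed {t : ℝ | v + t • H.chart z ∈ G} :=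
    h.isCompact.isClosed.preimage (by fun_prop : Continuous fun t : ℝ => v + t • H.chart z)
  exact hc.csInf_mem hz (h.bddBelow z)

theorem radius_pos (h : H.Sees G v) {z : E} (hz : z ∈ H.shadow G v) : 0 < H.radius G v z :=
  h.pos_of_mem (h.entry_mem hz)

theorem radius_bounds (h : H.Sees G v) : ∃ δ R : ℝ, 0 < δ ∧ 0 < R ∧
    (∀ z ∈ H.shadow G v, δ ≤ H.radius G v z ∧ H.radius G v z ≤ R ∧ ‖H.chart z‖ ≤ R) := by
  obtain ⟨δ, hδ, hb⟩ := h.pos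
  obtain ⟨R, hR, hbR⟩ := (h.isCompact.image
    (continuous_id.sub (continuous_const (y := v)))).isBounded.exists_pos_norm_le
  -- Here |entry - v| = radius · |chart| ≤ R. The bound |chart| ≥ 1 gives radius ≤ R, and radius ≥ δ
  -- gives |chart| ≤ R / δ.
  refine ⟨δ, max R (R / δ), hδ, lt_max_of_lt_left hR, fun z hz => ?_⟩
  have hm := h.entry_mem hz
  have h1 := hb _ hm
  rw [entry, inner_normal_smul_chart] at h1
  have h2 := hbR _ (mem_image_of_mem _ hm)
  simp only [id, entry, Pi.sub_apply, add_sub_cancel_left, norm_smul, Real.norm_eq_abs,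
    abs_of_pos (h.radius_pos hz)] at h2
  refine ⟨h1, le_max_of_le_left (le_trans ?_ h2), le_max_of_le_right ?_⟩
  · exact le_mul_of_one_le_right (h.radius_pos hz).le (H.one_le_norm_chart z)
  · rw [le_div_iff₀ hδ]
    nlinarith [norm_nonneg (H.chart z)]

end Sees

theorem shadow_mono {A B : Set F} (hAB : A ⊆ B) : H.shadow A v ⊆ H.shadow B v :=
  fun _ ⟨t, ht⟩ => ⟨t, hAB ht⟩

theorem isOpen_shadow {A : Set F} (hA : IsOpen A) : IsOpen (H.shadow A v) := by
  have : H.shadow A v = ⋃ t : ℝ, (fun z => v + t • H.chart z) ⁻¹' A := by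
    ext z
    simp [shadow]
  rw [this]
  exact isOpen_iUnion fun t => hA.preimage
    (continuous_const.add (continuous_const.smul H.continuous_chart))

theorem chart_combo {a b : ℝ} (hab : a + b = 1) (z w : E) :
    H.chart (a • z + b • w) = a • H.chart z + b • H.chart w := by
  have : H.normal = a • H.normal + b • H.normal := by rw [← add_smul, hab, one_smul]
  rw [chart, map_add, map_smul, map_smul, chart, chart, smul_add, smul_add]
  conv_lhs => rw [this]
  abel

/-- Convexity in perspective: the inverse of the height parameter is an affine coordinate. -/
theorem perspective_mem {A : Set F} (hA : Convex ℝ A) {z w : E} {p q : ℝ} (hp : 0 < p) (hq : 0 < q)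
    (hz : v + p⁻¹ • H.chart z ∈ A) (hw : v + q⁻¹ • H.chart w ∈ A) {a b : ℝ} (ha : 0 ≤ a)
    (hb : 0 ≤ b) (hab : a + b = 1) :
    v + (a * p + b * q)⁻¹ • H.chart (a • z + b • w) ∈ A := by
  have hpos : 0 < a * p + b * q := by
    rcases ha.eq_or_lt with rfl | ha'
    · have : b = 1 := by linarith
      subst this
      linarith
    · have := mul_pos ha' hp
      have := mul_nonneg hb hq.le
      linarith
  -- The weights are proportional to a p and b q, so that the factors p⁻¹ and q⁻¹ cancel and leave
  -- the combination of charts.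
  have h := hA hz hw (a := a * p / (a * p + b * q)) (b := b * q / (a * p + b * q))
    (by positivity) (by positivity) (by rw [← add_div, div_self hpos.ne'])
  convert h using 1
  have hne := hpos.ne'
  rw [chart_combo hab]
  match_scalars <;> field_simp

namespace Sees

theorem convex_shadow (h : H.Sees G v) {A : Set F} (hAG : A ⊆ G) (hA : Convex ℝ A) :
    Convex ℝ (H.shadow A v) := by
  rintro z ⟨t, ht⟩ w ⟨t', ht'⟩ a b ha hb hab
  have h1 := h.pos_of_mem (hAG ht)
  have h2 := h.pos_of_mem (hAG ht')
  exact ⟨_, perspective_mem hA (inv_pos.2 h1) (inv_pos.2 h2) (by rwa [inv_inv]) (by rwa [inv_inv])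
    ha hb hab⟩

/-- The perspective combination of two entry points lies in G, so its parameter is at least the
radius there. Concavity is the source of all regularity of the entry map. -/
theorem concaveOn_inv_radius (h : H.Sees G v) :
    ConcaveOn ℝ (H.shadow G v) fun z => (H.radius G v z)⁻¹ := by
  refine ⟨h.convex_shadow Subset.rfl h.convex, fun z hz w hw a b ha hb hab => ?_⟩
  have h1 := h.radius_pos hz
  have h2 := h.radius_pos hw
  have hm := perspective_mem h.convex (inv_pos.2 h1) (inv_pos.2 h2)
    (by rw [inv_inv]; exact h.entry_mem hz) (by rw [inv_inv]; exact h.entry_mem hw) ha hb hab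
  have hle := h.radius_le hm
  have hpos := h.radius_pos ⟨_, hm⟩
  rw [smul_eq_mul, smul_eq_mul]
  have := inv_anti₀ hpos hle
  rwa [inv_inv] at this

/-- A concave function is locally Lipschitz on an open convex set. Passing to the inverse costs a
factor R², since r - r' = -r r' (1/r - 1/r'). -/
theorem locallyLipschitzOn_radius (h : H.Sees G v) :
    LocallyLipschitzOn (H.shadow (interior G) v) (H.radius G v) := by
  have hsub : H.shadow (interior G) v ⊆ H.shadow G v := shadow_mono interior_subset
  have hτ := (h.concaveOn_inv_radius.subset hsub
    (h.convex_shadow interior_subset h.convex.interior)).locallyLipschitzOn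
    (isOpen_shadow isOpen_interior)
  obtain ⟨δ, R, hδ, hR, hb⟩ := h.radius_bounds
  intro z hz
  obtain ⟨K, t, ht, hK⟩ := hτ hz
  refine ⟨Real.toNNReal (R ^ 2) * K, t ∩ H.shadow (interior G) v,
    inter_mem ht self_mem_nhdsWithin, LipschitzOnWith.of_dist_le_mul fun x hx y hy => ?_⟩
  have hd := hK.dist_le_mul x hx.1 y hy.1
  have hx' := hb x (hsub hx.2)
  have hy' := hb y (hsub hy.2)
  have hx0 := h.radius_pos (hsub hx.2)
  have hy0 := h.radius_pos (hsub hy.2)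
  rw [Real.dist_eq] at hd ⊢
  have e : H.radius G v x - H.radius G v y = -(H.radius G v x * H.radius G v y) *
      ((H.radius G v x)⁻¹ - (H.radius G v y)⁻¹) := by
    field_simp
    ring
  rw [e, abs_mul, abs_neg, abs_of_pos (mul_pos hx0 hy0), NNReal.coe_mul,
    Real.coe_toNNReal _ (by positivity), mul_assoc (R ^ 2)]
  refine mul_le_mul ?_ hd (abs_nonneg _) (by positivity)
  rw [sq]
  exact mul_le_mul hx'.2.1 hy'.2.1 hy0.le hR.le

theorem locallyLipschitzOn_entry (h : H.Sees G v) :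
    LocallyLipschitzOn (H.shadow (interior G) v) (H.entry G v) := by
  have hsub : H.shadow (interior G) v ⊆ H.shadow G v := shadow_mono interior_subset
  obtain ⟨δ, R, hδ, hR, hb⟩ := h.radius_bounds
  intro z hz
  obtain ⟨K, t, ht, hK⟩ := h.locallyLipschitzOn_radius hz
  refine ⟨R.toNNReal * K + R.toNNReal, t ∩ H.shadow (interior G) v,
    inter_mem ht self_mem_nhdsWithin, LipschitzOnWith.of_dist_le_mul fun x hx y hy => ?_⟩
  have hd := hK.dist_le_mul x hx.1 y hy.1
  have hx' := hb x (hsub hx.2)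
  have hy' := hb y (hsub hy.2)
  have hy0 := h.radius_pos (hsub hy.2)
  have e : H.entry G v x - H.entry G v y = (H.radius G v x - H.radius G v y) • H.chart x +
      H.radius G v y • H.incl (x - y) := by
    simp only [entry, chart, map_sub]
    module
  rw [dist_eq_norm, e]
  refine (norm_add_le _ _).trans ?_
  rw [norm_smul, norm_smul, LinearIsometry.norm_map, ← dist_eq_norm, ← dist_eq_norm,
    Real.norm_eq_abs, abs_of_pos hy0]
  rw [NNReal.coe_add, NNReal.coe_mul, Real.coe_toNNReal _ hR.le, add_mul]
  refine add_le_add ?_ (mul_le_mul_of_nonneg_right hy'.2.1 dist_nonneg)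
  calc dist (H.radius G v x) (H.radius G v y) * ‖H.chart x‖
      ≤ (K * dist x y) * R := mul_le_mul hd hx'.2.2 (norm_nonneg _) (by positivity)
    _ = R * K * dist x y := by ring

/-- If the entry point were interior, the ray would already meet G at a smaller parameter. -/
theorem exists_interior_of_entry (h : H.Sees G v) {z : E}
    (hz : z ∈ H.shadow (interior G) v) : H.entry G v z ∉ interior G ∧
      ∃ t, H.radius G v z < t ∧ v + t • H.chart z ∈ interior G := by
  have hni : H.entry G v z ∉ interior G := by
    intro hi
    have hop : IsOpen {t : ℝ | v + t • H.chart z ∈ interior G} :=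
      isOpen_interior.preimage (by fun_prop : Continuous fun t : ℝ => v + t • H.chart z)
    obtain ⟨ε, hε, hball⟩ := Metric.isOpen_iff.1 hop (H.radius G v z) hi
    have hm := @hball (H.radius G v z - ε / 2) (by
      rw [mem_ball, Real.dist_eq, sub_sub_cancel_left, abs_neg, abs_of_pos (half_pos hε)]
      exact half_lt_self hε)
    have := h.radius_le (interior_subset hm)
    linarith
  refine ⟨hni, ?_⟩
  obtain ⟨t, ht⟩ := hz
  refine ⟨t, lt_of_le_of_ne (h.radius_le (interior_subset ht)) ?_, ht⟩
  rintro rfl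
  exact hni ht

theorem image_entry (h : H.Sees G v) :
    H.entry G v '' H.shadow (interior G) v = visiblePart G v := by
  ext x
  constructor
  · rintro ⟨z, hz, rfl⟩
    obtain ⟨hni, t, hrt, ht⟩ := h.exists_interior_of_entry hz
    have hz' := shadow_mono interior_subset hz
    have hr := h.radius_pos hz'
    refine ⟨⟨subset_closure (h.entry_mem hz'), hni⟩, (t - H.radius G v z) / H.radius G v z,
      div_pos (sub_pos.2 hrt) hr, ?_⟩
    convert ht using 1
    rw [entry, add_sub_cancel_left, smul_smul, div_mul_cancel₀ _ hr.ne', add_assoc, ← add_smul,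
      add_sub_cancel]
  · rintro ⟨hx, s, hs, hxs⟩
    obtain ⟨δ, hδ, hb⟩ := h.pos
    have hxG : x ∈ G := h.isCompact.isClosed.frontier_subset hx
    have ht : 0 < ⟪H.normal, x - v⟫ := hδ.trans_le (hb x hxG)
    have hxe := H.exists_eq_add_smul_chart ht
    set t := ⟪H.normal, x - v⟫
    set z := t⁻¹ • H.coord (x - v)
    have hxs' : x + s • (x - v) = v + ((1 + s) * t) • H.chart z := by
      conv_lhs => rw [hxe]
      rw [add_sub_cancel_left]
      module
    have hzU : z ∈ H.shadow (interior G) v := ⟨_, hxs' ▸ hxs⟩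
    refine ⟨z, hzU, ?_⟩
    have hzG : v + t • H.chart z ∈ G := hxe ▸ hxG
    suffices H.radius G v z = t by rw [entry, this, ← hxe]
    refine le_antisymm (h.radius_le hzG) (not_lt.1 fun hlt => hx.2 ?_)
    have hm := h.entry_mem ⟨t, hzG⟩
    have hst : 0 < s * t := mul_pos hs ht
    set r := H.radius G v z with hr
    obtain ⟨D, hD⟩ : ∃ D, D = (1 + s) * t - r := ⟨_, rfl⟩
    have hd : 0 < D := by linarith
    -- Were the radius r less than t, x would lie strictly between the entry point and an interior
    -- point, hence be interior. The weights solve a r + b (1 + s) t = t.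
    have := h.convex.combo_self_interior_mem_interior hm hxs
      (a := s * t / D) (b := (t - r) / D)
      (div_nonneg hst.le hd.le) (div_pos (by linarith) hd)
      (by rw [← add_div, div_eq_one_iff_eq hd.ne', hD]; ring)
    convert this using 1
    rw [hxs', hxe, entry, ← hr]
    match_scalars
    · field_simp
      rw [hD]
      ring
    · field_simp
      rw [hD]
      ring

theorem injOn_entry (h : H.Sees G v) : InjOn (H.entry G v) (H.shadow G v) :=
  fun _ hz _ _ hzw => (add_smul_chart_injective (h.radius_pos hz).ne' hzw).2

theorem isCompact_shadow (h : H.Sees G v) : IsCompact (H.shadow G v) := by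
  obtain ⟨δ, hδ, hb⟩ := h.pos
  have : H.shadow G v = (fun x => ⟪H.normal, x - v⟫⁻¹ • H.coord (x - v)) '' G := by
    ext z
    constructor
    · rintro ⟨t, ht⟩
      refine ⟨_, ht, ?_⟩
      simp only [inner_normal_smul_chart]
      rw [add_sub_cancel_left, map_smul, coord_chart, smul_smul,
        inv_mul_cancel₀ (h.pos_of_mem ht).ne', one_smul]
    · rintro ⟨x, hx, rfl⟩
      exact ⟨_, (H.exists_eq_add_smul_chart (hδ.trans_le (hb x hx))) ▸ hx⟩
  rw [this]
  refine h.isCompact.image_of_continuousOn (ContinuousOn.smul (ContinuousOn.inv₀ ?_ ?_) ?_)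
  · fun_prop
  · exact fun x hx => (hδ.trans_le (hb x hx)).ne'
  · fun_prop

theorem shadow_subset_closure (h : H.Sees G v) (hi : (interior G).Nonempty) :
    H.shadow G v ⊆ closure (H.shadow (interior G) v) := by
  rintro z ⟨t, ht⟩
  obtain ⟨δ, hδ, hb⟩ := h.pos
  set π : F → E := fun x => ⟪H.normal, x - v⟫⁻¹ • H.coord (x - v) with hπ
  have hz : π (v + t • H.chart z) = z := by
    simp only [hπ, inner_normal_smul_chart]
    rw [add_sub_cancel_left, map_smul, coord_chart, smul_smul,
      inv_mul_cancel₀ (h.pos_of_mem ht).ne', one_smul]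
  have hc : ContinuousAt π (v + t • H.chart z) := by
    refine ContinuousAt.smul (ContinuousAt.inv₀ (by fun_prop) (hδ.trans_le (hb _ ht)).ne') ?_
    fun_prop
  have hcl : v + t • H.chart z ∈ closure (interior G) := by
    rw [h.convex.closure_interior_eq_closure_of_nonempty_interior hi]
    exact subset_closure ht
  rw [← hz]
  refine closure_mono ?_ (mem_closure_image hc hcl)
  rintro _ ⟨x, hx, rfl⟩
  exact ⟨_, (H.exists_eq_add_smul_chart (hδ.trans_le (hb x (interior_subset hx)))) ▸ hx⟩

/-- The difference lies in the frontier of a convex set, which is null. -/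
theorem volume_shadow_diff [MeasurableSpace E] [BorelSpace E] (h : H.Sees G v)
    (hi : (interior G).Nonempty) :
    volume (H.shadow G v \ H.shadow (interior G) v) = 0 := by
  have hop : IsOpen (H.shadow (interior G) v) := isOpen_shadow isOpen_interior
  refine measure_mono_null ?_
    ((h.convex_shadow interior_subset h.convex.interior).addHaar_frontier volume)
  rw [frontier, hop.interior_eq]
  exact sdiff_subset_sdiff_left (h.shadow_subset_closure hi)

end Sees

end HyperplaneFrame

end Visible

/-! ### Outer normals: uniqueness, visibility and measurability -/

section Normals

variable {d : ℕ} {G : Set (EuclideanSpace ℝ (Fin d))}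

/-- `u` is the unique outer unit normal of `G` at `x`. -/
structure IsUniqueNormal (G : Set (EuclideanSpace ℝ (Fin d))) (x u : EuclideanSpace ℝ (Fin d)) :
    Prop where
  norm_eq_one : ‖u‖ = 1
  mem_normalCone : u ∈ normalCone G x
  exists_smul_eq : ∀ w ∈ normalCone G x, ∃ c : ℝ, 0 ≤ c ∧ w = c • u

/-- A small step from `y` along `u` stays in G and strictly increases the inner product with `u`. -/
theorem inner_neg_of_mem_interior {x u y : EuclideanSpace ℝ (Fin d)} (hu : u ∈ normalCone G x)
    (hu0 : u ≠ 0) (hy : y ∈ interior G) : ⟪u, y - x⟫ < 0 := by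
  have hop : IsOpen {t : ℝ | y + t • u ∈ interior G} :=
    isOpen_interior.preimage (by fun_prop : Continuous fun t : ℝ => y + t • u)
  obtain ⟨ε, hε, hball⟩ := Metric.isOpen_iff.1 hop 0 (by simpa using hy)
  have hm := @hball (ε / 2) (by
    rw [mem_ball, Real.dist_eq, sub_zero, abs_of_pos (half_pos hε)]
    exact half_lt_self hε)
  have h1 := hu _ (interior_subset hm)
  rw [add_sub_right_comm, inner_add_right, inner_smul_right, real_inner_self_eq_norm_sq] at h1
  have : 0 < ε / 2 * ‖u‖ ^ 2 := by positivity
  linarith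

/-- Hahn–Banach separates the interior of G from the ray; since x lies in both G and the ray, the
separating hyperplane supports G at x. The case w = 0 gives a normal at any non-interior point of G.
-/
theorem exists_mem_normalCone_of_ray (hG : Convex ℝ G) (hi : (interior G).Nonempty)
    {x w : EuclideanSpace ℝ (Fin d)} (hx : x ∈ G)
    (hw : ∀ s : ℝ, 0 ≤ s → x + s • w ∉ interior G) :
    ∃ u ∈ normalCone G x, u ≠ 0 ∧ 0 ≤ ⟪u, w⟫ := by
  have hray : Convex ℝ {y | ∃ s : ℝ, 0 ≤ s ∧ x + s • w = y} := by
    rintro _ ⟨s, hs, rfl⟩ _ ⟨t, ht, rfl⟩ a b ha hb hab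
    refine ⟨a * s + b * t, by positivity, ?_⟩
    have : x = a • x + b • x := by rw [← add_smul, hab, one_smul]
    conv_lhs => rw [this]
    module
  obtain ⟨f, c, hf, hfG, hfr⟩ := geometric_hahn_banach_of_nonempty_interior hG hray
    (disjoint_left.2 (by rintro _ hy ⟨s, hs, rfl⟩; exact hw s hs hy)) hi ⟨x, 0, le_rfl, by simp⟩
  have hxc : f x = c := le_antisymm (hfG x hx) (hfr x ⟨0, le_rfl, by simp⟩)
  refine ⟨(InnerProductSpace.toDual ℝ _).symm f, fun y hy => ?_, by simpa using hf, ?_⟩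
  · rw [InnerProductSpace.toDual_symm_apply, map_sub, hxc]
    linarith [hfG y hy]
  · have := hfr (x + w) ⟨1, zero_le_one, by simp⟩
    rw [map_add, hxc] at this
    rw [InnerProductSpace.toDual_symm_apply]
    linarith

namespace IsUniqueNormal

variable {x u : EuclideanSpace ℝ (Fin d)}

theorem ne_zero (h : IsUniqueNormal G x u) : u ≠ 0 := by
  rintro rfl
  simpa using h.norm_eq_one

theorem eq_of_mem (h : IsUniqueNormal G x u) {w : EuclideanSpace ℝ (Fin d)}
    (hw : w ∈ normalCone G x) (hw1 : ‖w‖ = 1) : w = u := by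
  obtain ⟨c, hc, rfl⟩ := h.exists_smul_eq w hw
  rw [norm_smul, h.norm_eq_one, mul_one, Real.norm_eq_abs, abs_of_nonneg hc] at hw1
  rw [hw1, one_smul]

theorem tangentSpace_eq (h : IsUniqueNormal G x u) : tangentSpace G x = (ℝ ∙ u)ᗮ := by
  rw [tangentSpace]
  congr 1
  refine le_antisymm (Submodule.span_le.2 fun w hw => ?_) (Submodule.span_mono ?_)
  · obtain ⟨c, -, rfl⟩ := h.exists_smul_eq w hw
    exact Submodule.smul_mem _ _ (Submodule.mem_span_singleton_self u)
  · exact singleton_subset_iff.2 h.mem_normalCone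

theorem mem_visiblePart_iff (h : IsUniqueNormal G x u) (hG : Convex ℝ G)
    (hi : (interior G).Nonempty) (hx : x ∈ frontier G) (hxG : x ∈ G)
    (v : EuclideanSpace ℝ (Fin d)) : x ∈ visiblePart G v ↔ 0 < ⟪v - x, u⟫ := by
  have hneg : ⟪v - x, u⟫ = -⟪u, x - v⟫ := by
    rw [real_inner_comm, ← inner_neg_right, neg_sub]
  rw [hneg]
  constructor
  · rintro ⟨-, s, hs, hxs⟩
    have := inner_neg_of_mem_interior h.mem_normalCone h.ne_zero hxs
    rw [add_sub_cancel_left, inner_smul_right] at this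
    nlinarith
  · intro hpos
    by_contra hn
    -- An invisible point has a nonzero normal making a nonnegative inner product with x - v;
    -- uniqueness makes it a positive multiple of u, a contradiction.
    obtain ⟨w, hw, hw0, hwv⟩ := exists_mem_normalCone_of_ray hG hi hxG (w := x - v) (by
      intro s hs hxs
      rcases hs.eq_or_lt with rfl | hs'
      · rw [zero_smul, add_zero] at hxs
        exact hx.2 hxs
      · exact hn ⟨hx, s, hs', hxs⟩)
    obtain ⟨c, hc, rfl⟩ := h.exists_smul_eq w hw
    rw [real_inner_smul_left] at hwv
    have hc' : 0 < c := lt_of_le_of_ne hc (by rintro rfl; simp at hw0)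
    nlinarith

end IsUniqueNormal

/-- A choice of outer unit normal, meaningful where it is unique. -/
noncomputable def outerNormal (G : Set (EuclideanSpace ℝ (Fin d)))
    (x : EuclideanSpace ℝ (Fin d)) : EuclideanSpace ℝ (Fin d) :=
  open Classical in if h : ∃ u, IsUniqueNormal G x u then h.choose else 0

theorem isUniqueNormal_outerNormal {x : EuclideanSpace ℝ (Fin d)}
    (h : ∃ u, IsUniqueNormal G x u) : IsUniqueNormal G x (outerNormal G x) := by
  rw [outerNormal, dif_pos h]
  exact h.choose_spec

/-- Unit normals at points tending to x accumulate, by compactness of the sphere, only at unit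
normals at x, and there is just one. -/
theorem continuousOn_outerNormal :
    ContinuousOn (outerNormal G) {x | ∃ u, IsUniqueNormal G x u} := by
  intro x hx
  rw [ContinuousWithinAt, tendsto_iff_ultrafilter]
  intro g hg
  have hR : ∀ᶠ y in (g : Filter _), IsUniqueNormal G y (outerNormal G y) := by
    filter_upwards [hg self_mem_nhdsWithin] with y hy using isUniqueNormal_outerNormal hy
  have hgx : Tendsto id (g : Filter _) (𝓝 x) := hg.trans nhdsWithin_le_nhds
  obtain ⟨w, hw, hgw⟩ := (isCompact_sphere (0 : EuclideanSpace ℝ (Fin d)) 1).ultrafilter_le_nhds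
    (g.map (outerNormal G)) (by
      rw [le_principal_iff]
      refine Ultrafilter.mem_map.2 ?_
      filter_upwards [hR] with y hy
      simpa using hy.norm_eq_one)
  have hgw' : Tendsto (outerNormal G) g (𝓝 w) := hgw
  have hwx : w = outerNormal G x := by
    refine (isUniqueNormal_outerNormal hx).eq_of_mem (fun y hy => ?_) (by simpa using hw)
    refine le_of_tendsto (hgw'.inner (tendsto_const_nhds.sub hgx)) ?_
    filter_upwards [hR] with x' hx' using hx'.mem_normalCone y hy
  rwa [← hwx]

variable {E : Type*} [NormedAddCommGroup E] [InnerProductSpace ℝ E] [FiniteDimensional ℝ E]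
  {H : HyperplaneFrame E (EuclideanSpace ℝ (Fin d))} {v : EuclideanSpace ℝ (Fin d)}

namespace HyperplaneFrame

variable (H) in
/-- The derivative of the entry map. -/
noncomputable def entryDeriv (G : Set (EuclideanSpace ℝ (Fin d))) (v : EuclideanSpace ℝ (Fin d))
    (z : E) : E →L[ℝ] EuclideanSpace ℝ (Fin d) :=
  H.radius G v z • H.incl.toContinuousLinearMap +
    (fderiv ℝ (H.radius G v) z).smulRight (H.chart z)

theorem hasFDerivAt_entry {z : E} (hz : DifferentiableAt ℝ (H.radius G v) z) :
    HasFDerivAt (H.entry G v) (H.entryDeriv G v z) z :=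
  H.hasFDerivAt_cone v hz.hasFDerivAt

namespace Sees

theorem inner_chart_neg (h : H.Sees G v) {z : E} (hz : z ∈ H.shadow (interior G) v)
    {u : EuclideanSpace ℝ (Fin d)} (hu : u ∈ normalCone G (H.entry G v z)) (hu0 : u ≠ 0) :
    ⟪u, H.chart z⟫ < 0 := by
  obtain ⟨-, t, ht, hti⟩ := h.exists_interior_of_entry hz
  have := inner_neg_of_mem_interior hu hu0 hti
  rw [entry, add_sub_add_left_eq_sub, ← sub_smul, inner_smul_right] at this
  nlinarith

/-- The entry map stays in G, so ⟨u, entry⟩ has a local maximum at z: normals are orthogonal to the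
image of the derivative. -/
theorem inner_entryDeriv (h : H.Sees G v) {z : E} (hz : z ∈ H.shadow (interior G) v)
    (hd : DifferentiableAt ℝ (H.radius G v) z) {u : EuclideanSpace ℝ (Fin d)}
    (hu : u ∈ normalCone G (H.entry G v z)) (w : E) : ⟪u, H.entryDeriv G v z w⟫ = 0 := by
  have hmax : IsLocalMax (fun z' => ⟪u, H.entry G v z'⟫) z := by
    filter_upwards [(isOpen_shadow isOpen_interior).mem_nhds hz] with z' hz'
    have := hu _ (h.entry_mem (shadow_mono interior_subset hz'))
    rw [inner_sub_right] at this
    linarith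
  have hder : HasFDerivAt (fun z' => ⟪u, H.entry G v z'⟫)
      ((innerSL ℝ u).comp (H.entryDeriv G v z)) z :=
    (innerSL ℝ u).hasFDerivAt.comp z (hasFDerivAt_entry hd)
  have := hmax.hasFDerivAt_eq_zero hder
  simpa using congrArg (fun L => L w) this

theorem exists_isUniqueNormal (h : H.Sees G v) {z : E} (hz : z ∈ H.shadow (interior G) v)
    (hd : DifferentiableAt ℝ (H.radius G v) z) : ∃ u, IsUniqueNormal G (H.entry G v z) u := by
  have hz' := shadow_mono interior_subset hz
  obtain ⟨t, ht⟩ := id hz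
  obtain ⟨u₀, hu₀, hu₀0, -⟩ := exists_mem_normalCone_of_ray h.convex ⟨_, ht⟩ (h.entry_mem hz')
    (w := 0) fun s _ => by simpa using (h.exists_interior_of_entry hz).1
  have hn : 0 < ‖u₀‖ := norm_pos_iff.2 hu₀0
  set u := ‖u₀‖⁻¹ • u₀ with hudef
  have hu1 : ‖u‖ = 1 := by rw [hudef, norm_smul, norm_inv, norm_norm, inv_mul_cancel₀ hn.ne']
  have hu : u ∈ normalCone G (H.entry G v z) := fun y hy => by
    rw [hudef, real_inner_smul_left]
    exact mul_nonpos_of_nonneg_of_nonpos (by positivity) (hu₀ y hy)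
  have hu0 : u ≠ 0 := by
    intro h0
    rw [h0, norm_zero] at hu1
    exact zero_ne_one hu1
  have hk := h.inner_chart_neg hz hu hu0
  refine ⟨u, hu1, hu, fun w hw => ?_⟩
  by_cases hw0 : w = 0
  · exact ⟨0, le_rfl, by rw [hw0, zero_smul]⟩
  have hkw := h.inner_chart_neg hz hw hw0
  -- This c makes w - c u orthogonal to the chart vector. Being orthogonal to the image of the
  -- derivative too, w - c u is orthogonal to the whole hyperplane and to its normal, hence zero.
  refine ⟨⟪w, H.chart z⟫ / ⟪u, H.chart z⟫, (div_pos_of_neg_of_neg hkw hk).le, ?_⟩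
  set c := ⟪w, H.chart z⟫ / ⟪u, H.chart z⟫ with hc
  have hq : ⟪w - c • u, H.chart z⟫ = 0 := by
    rw [inner_sub_left, real_inner_smul_left, hc, div_mul_cancel₀ _ hk.ne, sub_self]
  have hort : ∀ p, ⟪w - c • u, H.incl p⟫ = 0 := by
    intro p
    have h1 : ⟪w - c • u, H.entryDeriv G v z p⟫ = 0 := by
      rw [inner_sub_left, real_inner_smul_left, h.inner_entryDeriv hz hd hw,
        h.inner_entryDeriv hz hd hu, mul_zero, sub_zero]
    simp only [entryDeriv, FunLike.coe_add, Pi.add_apply, FunLike.coe_smul, Pi.smul_apply,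
      ContinuousLinearMap.smulRight_apply, LinearIsometry.coe_toContinuousLinearMap,
      inner_add_right, inner_smul_right, hq, mul_zero, add_zero] at h1
    exact (mul_eq_zero.1 h1).resolve_left (h.radius_pos hz').ne'
  have he := H.exists_eq_of_orthogonal hort
  have h2 : ⟪H.normal, w - c • u⟫ = 0 := by
    rw [chart, inner_add_right, hort, add_zero, real_inner_comm] at hq
    exact hq
  rw [h2, zero_smul] at he
  exact sub_eq_zero.1 he

end Sees

end HyperplaneFrame

/-- The frame normal is the normalized vector of a functional strictly separating v from G. -/
theorem exists_sees (hdim : d = finrank ℝ E + 1) (hG : IsConvexBody G) (hv : v ∉ G) :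
    ∃ H : HyperplaneFrame E (EuclideanSpace ℝ (Fin d)), H.Sees G v := by
  obtain ⟨hc, hconv, ⟨y, hy⟩⟩ := hG
  obtain ⟨f, c, hfv, hfG⟩ := geometric_hahn_banach_point_closed hconv hc.isClosed hv
  set e₀ := (InnerProductSpace.toDual ℝ (EuclideanSpace ℝ (Fin d))).symm f with he₀
  have hfe : ∀ w, ⟪e₀, w⟫ = f w := fun w => InnerProductSpace.toDual_symm_apply
  have hne : e₀ ≠ 0 := by
    intro h0
    have h1 := hfG y (interior_subset hy)
    rw [← hfe, h0, inner_zero_left] at h1 hfv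
    linarith
  have hn : 0 < ‖e₀‖ := norm_pos_iff.2 hne
  obtain ⟨H, hH⟩ := exists_hyperplaneFrame (E := E) (F := EuclideanSpace ℝ (Fin d))
    (by rw [finrank_euclideanSpace_fin, hdim]) (e := ‖e₀‖⁻¹ • e₀)
    (by rw [norm_smul, norm_inv, norm_norm, inv_mul_cancel₀ hn.ne'])
  refine ⟨H, hc, hconv, ‖e₀‖⁻¹ * (c - f v), mul_pos (inv_pos.2 hn) (sub_pos.2 hfv), fun x hx => ?_⟩
  rw [hH, real_inner_smul_left, inner_sub_right, hfe, hfe]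
  have := hfG x hx
  gcongr

variable [MeasurableSpace E] [BorelSpace E]

namespace HyperplaneFrame

variable (H) in
/-- The parameters at which the ray from `v` enters `G` through a smooth point. -/
def smoothShadow (G : Set (EuclideanSpace ℝ (Fin d))) (v : EuclideanSpace ℝ (Fin d)) : Set E :=
  {z | z ∈ H.shadow (interior G) v ∧ DifferentiableAt ℝ (H.radius G v) z}

theorem measurableSet_smoothShadow : MeasurableSet (H.smoothShadow G v) :=
  (isOpen_shadow isOpen_interior).measurableSet.inter (measurableSet_of_differentiableAt ℝ _)

namespace Sees

theorem volume_diff_smoothShadow (h : H.Sees G v) :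
    volume (H.shadow (interior G) v \ H.smoothShadow G v) = 0 := by
  have := ae_differentiableAt_of_locallyLipschitzOn (isOpen_shadow isOpen_interior)
    h.locallyLipschitzOn_radius
  refine measure_mono_null (fun z hz => ?_) this
  exact fun h' => hz.2 ⟨hz.1, h' hz.1⟩

theorem measure_visiblePart_diff (h : H.Sees G v) :
    μHE[finrank ℝ E] (visiblePart G v \ H.entry G v '' H.smoothShadow G v) = 0 := by
  rw [← h.image_entry]
  refine measure_mono_null (t := H.entry G v '' (H.shadow (interior G) v \ H.smoothShadow G v)) ?_ ?_
  · rintro _ ⟨⟨z, hz, rfl⟩, hn⟩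
    exact ⟨z, ⟨hz, fun hz' => hn ⟨z, hz', rfl⟩⟩, rfl⟩
  exact euclideanHausdorffMeasure_image_eq_zero_of_locallyLipschitzOn h.locallyLipschitzOn_entry
    sdiff_subset h.volume_diff_smoothShadow

end Sees

end HyperplaneFrame

variable (E) in
/-- The outer unit normal of a convex body is unique at almost every boundary point. -/
theorem measure_not_isUniqueNormal (hdim : d = finrank ℝ E + 1) (hG : IsConvexBody G) :
    μHE[finrank ℝ E] {x | x ∈ frontier G ∧ ¬ ∃ u, IsUniqueNormal G x u} = 0 := by
  obtain ⟨D, hDc, hDd⟩ := TopologicalSpace.exists_countable_dense (EuclideanSpace ℝ (Fin d))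
  have hsub : {x | x ∈ frontier G ∧ ¬ ∃ u, IsUniqueNormal G x u} ⊆
      ⋃ v ∈ D \ G, {x | x ∈ visiblePart G v ∧ ¬ ∃ u, IsUniqueNormal G x u} := by
    rintro x ⟨hx, hxn⟩
    obtain ⟨c, hc⟩ := hG.2.2
    have hop : IsOpen {v | x + (1 : ℝ) • (x - v) ∈ interior G} :=
      isOpen_interior.preimage (by fun_prop)
    -- The reflection 2x - c of an interior point c sees x, and so do all nearby points. Thus
    -- countably many viewpoints suffice.
    obtain ⟨v, hvD, hv⟩ := hDd.exists_mem_open hop ⟨x + (x - c), by simpa using hc⟩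
    have hvG : v ∉ G := by
      intro hvG
      have := hG.2.1.combo_self_interior_mem_interior hvG hv (a := 1 / 2) (b := 1 / 2)
        (by norm_num) (by norm_num) (by norm_num)
      refine hx.2 ?_
      convert this using 1
      module
    exact mem_iUnion₂.2 ⟨v, ⟨hvD, hvG⟩, ⟨hx, 1, one_pos, hv⟩, hxn⟩
  refine measure_mono_null hsub ((measure_biUnion_null_iff (hDc.mono sdiff_subset)).2 ?_)
  rintro v ⟨-, hvG⟩
  obtain ⟨H, h⟩ := exists_sees (E := E) hdim hG hvG
  refine measure_mono_null ?_ h.measure_visiblePart_diff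
  rintro x ⟨hxv, hxn⟩
  refine ⟨hxv, ?_⟩
  rintro ⟨z, hz, rfl⟩
  exact hxn (h.exists_isUniqueNormal hz.1 hz.2)

end Normals

/-! ### Polar duality: facets, projections and sections -/

section Duality

variable {d : ℕ} {K : Set (EuclideanSpace ℝ (Fin d))} {x : EuclideanSpace ℝ (Fin d)}

theorem finslerBall_eq (hc : IsCompact K) (hK : Convex ℝ K) (hx : x ∈ interior K) :
    finslerBall K x = {w | x + w ∈ K} := by
  ext w
  rw [finslerBall, mem_ofPred_eq, mem_ofPred_eq, finslerNorm]
  by_cases hw : w = 0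
  · simp [hw, interior_subset hx]
  rw [if_neg hw]
  set S : Set ℝ := {t | x + t • w ∈ K} with hS
  have hcont : Continuous fun t : ℝ => x + t • w := by fun_prop
  have hcl : IsClosed S := hc.isClosed.preimage hcont
  have hwn : 0 < ‖w‖ := norm_pos_iff.2 hw
  have hbdd : BddAbove S := by
    obtain ⟨R, hR⟩ := hc.isBounded.exists_norm_le
    refine ⟨(R + ‖x‖) / ‖w‖, fun t ht => ?_⟩
    rw [le_div_iff₀ hwn]
    have h1 := norm_sub_le (x + t • w) x
    rw [add_sub_cancel_left, norm_smul, Real.norm_eq_abs] at h1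
    have h2 := hR _ ht
    nlinarith [le_abs_self t]
  obtain ⟨ε, hε, hball⟩ := Metric.isOpen_iff.1 (isOpen_interior.preimage hcont) 0
    (by simpa using hx)
  have hmε : ε / 2 ∈ S := by
    have hm := @hball (ε / 2) (by
      rw [mem_ball, Real.dist_eq, sub_zero, abs_of_pos (half_pos hε)]
      exact half_lt_self hε)
    exact interior_subset (s := K) hm
  have hpos : 0 < sSup S := (half_pos hε).trans_le (le_csSup hbdd hmε)
  have hmem : sSup S ∈ S := hcl.csSup_mem ⟨_, hmε⟩ hbdd
  rw [div_le_one hpos]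
  constructor
  · intro h1
    -- When the exit parameter is at least 1, x + w lies on the segment from x to the exit point.
    have := hK (interior_subset hx) hmem (a := 1 - (sSup S)⁻¹) (b := (sSup S)⁻¹)
      (sub_nonneg.2 (inv_le_one_of_one_le₀ h1)) (inv_nonneg.2 hpos.le) (by ring)
    convert this using 1
    match_scalars <;> field_simp
    ring
  · intro h1
    exact le_csSup hbdd (by simpa [hS] using h1)

theorem mem_polar_cone_translateBy {v y : EuclideanSpace ℝ (Fin d)} :
    y ∈ polar (cone (translateBy K v)) ↔ ∀ w ∈ K, ⟪w - v, y⟫ ≤ 0 := by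
  constructor
  · intro h w hw
    by_contra! hpos
    -- A positive inner product could be scaled up to 2, violating the bound 1.
    have := h ((2 / ⟪w - v, y⟫) • (w - v)) ⟨_, by positivity, _, mem_image_of_mem _ hw, rfl⟩
    rw [real_inner_smul_left, div_mul_cancel₀ _ hpos.ne'] at this
    norm_num at this
  · rintro h _ ⟨γ, hγ, _, ⟨w, hw, rfl⟩, rfl⟩
    rw [real_inner_smul_left]
    exact (mul_nonpos_of_nonneg_of_nonpos hγ (h w hw)).trans zero_le_one

theorem isClosed_polar (A : Set (EuclideanSpace ℝ (Fin d))) : IsClosed (polar A) := by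
  have : polar A = ⋂ x ∈ A, {y | ⟪x, y⟫ ≤ 1} := by
    ext y
    simp [polar]
  rw [this]
  exact isClosed_biInter fun x _ => isClosed_le (by fun_prop) continuous_const

/-- The polar of a cone is itself closed under nonnegative scaling. -/
theorem dualCrossSection_smul (A : Set (EuclideanSpace ℝ (Fin d))) (s : EuclideanSpace ℝ (Fin d))
    {c : ℝ} (hc : 0 < c) :
    dualCrossSection (cone A) (c • s) = c⁻¹ • dualCrossSection (cone A) s := by
  have hscale : ∀ {k : ℝ} {y : EuclideanSpace ℝ (Fin d)}, 0 ≤ k → y ∈ polar (cone A) →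
      k • y ∈ polar (cone A) := by
    rintro k y hk hy _ ⟨γ, hγ, w, hw, rfl⟩
    rw [inner_smul_right, ← real_inner_smul_left, smul_smul]
    exact hy _ ⟨_, mul_nonneg hk hγ, w, hw, rfl⟩
  ext y
  rw [mem_inv_smul_set_iff₀ hc.ne']
  simp only [dualCrossSection, mem_ofPred_eq, real_inner_smul_left, inner_smul_right]
  refine and_congr_left fun _ => ⟨hscale hc.le, fun h => ?_⟩
  simpa [smul_smul, inv_mul_cancel₀ hc.ne'] using hscale (inv_nonneg.2 hc.le) h

theorem euclideanHausdorffMeasure_dualCrossSection_smul (n : ℕ)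
    (A : Set (EuclideanSpace ℝ (Fin d))) (s : EuclideanSpace ℝ (Fin d)) {c : ℝ} (hc : 0 < c) :
    μHE[n] (dualCrossSection (cone A) (c • s)) =
      ENNReal.ofReal (c⁻¹ ^ n) * μHE[n] (dualCrossSection (cone A) s) := by
  rw [dualCrossSection_smul A s hc,
    Measure.euclideanHausdorffMeasure_smul₀ n (inv_ne_zero hc.ne'), ENNReal.smul_def, smul_eq_mul]
  congr 1
  rw [ENNReal.ofReal_pow (inv_nonneg.2 hc.le), ENNReal.coe_pow, ← enorm_eq_nnnorm,
    Real.enorm_of_nonneg (inv_nonneg.2 hc.le)]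

variable {E : Type*} [NormedAddCommGroup E] [InnerProductSpace ℝ E] [FiniteDimensional ℝ E]
  [MeasurableSpace E] [BorelSpace E]

theorem volume_inner_eq_const {h : E} (hh : h ≠ 0) (c : ℝ) : volume {p : E | ⟪h, p⟫ = c} = 0 := by
  rcases Set.eq_empty_or_nonempty {p : E | ⟪h, p⟫ = c} with he | ⟨p₀, hp₀⟩
  · rw [he, measure_empty]
  have : {p : E | ⟪h, p⟫ = c} = (fun p => p - p₀) ⁻¹' (LinearMap.ker (innerₛₗ ℝ h) : Set E) := by
    ext p
    simp only [mem_preimage, SetLike.mem_coe, LinearMap.mem_ker, innerₛₗ_apply_apply,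
      inner_sub_right, mem_ofPred_eq]
    rw [mem_ofPred_eq] at hp₀
    rw [hp₀, sub_eq_zero]
  rw [this]
  simp only [sub_eq_add_neg]
  rw [measure_preimage_add_right]
  refine Measure.addHaar_submodule _ _ fun htop => hh ?_
  have hm : h ∈ LinearMap.ker (innerₛₗ ℝ h) := htop ▸ Submodule.mem_top
  simpa using hm

namespace HyperplaneFrame

variable (H : HyperplaneFrame E (EuclideanSpace ℝ (Fin d)))

/-- The projection along the frame normal of the facet of the polar of `K - x` dual to `v`. -/
def projectedFacet (K : Set (EuclideanSpace ℝ (Fin d))) (x v : EuclideanSpace ℝ (Fin d)) : Set E :=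
  {p | H.incl p + ((-1 - ⟪x - v, H.incl p⟫) / ⟪x - v, H.normal⟫) • H.normal ∈
    polar (cone (translateBy K v))}

theorem isClosed_projectedFacet (K : Set (EuclideanSpace ℝ (Fin d)))
    (x v : EuclideanSpace ℝ (Fin d)) : IsClosed (H.projectedFacet K x v) := by
  have := H.incl.continuous
  exact (isClosed_polar _).preimage (by fun_prop)

theorem measure_dualCrossSection (s : EuclideanSpace ℝ (Fin d)) (hs : ⟪s, H.normal⟫ ≠ 0)
    (C : Set (EuclideanSpace ℝ (Fin d))) :
    μHE[finrank ℝ E] (dualCrossSection C s) =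
      ENNReal.ofReal (‖s‖ / |⟪s, H.normal⟫|) *
        volume {p | H.incl p + ((-1 - ⟪s, H.incl p⟫) / ⟪s, H.normal⟫) • H.normal ∈ polar C} :=
  H.euclideanHausdorffMeasure_slice hs (-1) (polar C)

/-- The slice formula with s = x - v, solved for the projected volume; the factor is the cosine
between v - x and the frame normal. -/
theorem volume_projectedFacet {v : EuclideanSpace ℝ (Fin d)} (hv : 0 < ⟪v - x, H.normal⟫) :
    volume (H.projectedFacet K x v) = ENNReal.ofReal (⟪v - x, H.normal⟫ / ‖x - v‖) *
      μHE[finrank ℝ E] (dualCrossSection (cone (translateBy K v)) (x - v)) := by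
  have hneg : ⟪x - v, H.normal⟫ = -⟪v - x, H.normal⟫ := by rw [← inner_neg_left, neg_sub]
  have hn : 0 < ‖x - v‖ := by
    rw [norm_pos_iff, sub_ne_zero]
    rintro rfl
    simp at hv
  rw [H.measure_dualCrossSection (x - v) (by rw [hneg]; exact (neg_lt_zero.2 hv).ne),
    ← mul_assoc, ← ENNReal.ofReal_mul (by positivity), hneg, abs_neg, abs_of_pos hv,
    div_mul_div_cancel₀ hn.ne', div_self hv.ne', ENNReal.ofReal_one, one_mul, ← hneg]
  rfl

theorem sub_inner_div_eq {v : EuclideanSpace ℝ (Fin d)} (p : E) :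
    (-1 - ⟪x - v, H.incl p⟫) / ⟪x - v, H.normal⟫ =
      (1 - ⟪v - x, H.incl p⟫) / ⟪v - x, H.normal⟫ := by
  have hneg : ∀ w, ⟪x - v, w⟫ = -⟪v - x, w⟫ := fun w => by rw [← inner_neg_left, neg_sub]
  rw [hneg, hneg, ← neg_div_neg_eq]
  congr 1 <;> ring

theorem inner_lift_eq_one {v : EuclideanSpace ℝ (Fin d)} (hv : 0 < ⟪v - x, H.normal⟫) (p : E) :
    ⟪v - x, H.incl p + ((1 - ⟪v - x, H.incl p⟫) / ⟪v - x, H.normal⟫) • H.normal⟫ = 1 := by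
  rw [inner_add_right, inner_smul_right, div_mul_cancel₀ _ hv.ne']
  ring

/-- The polar of a hyperplane section of `K - x` is the union of the projections of those facets
of the polar of `K - x` that face the direction of the normal. -/
theorem polar_section_eq_iUnion_projectedFacet (V : Finset (EuclideanSpace ℝ (Fin d)))
    (hKV : K = convexHull ℝ (V : Set (EuclideanSpace ℝ (Fin d)))) (hx : x ∈ interior K) :
    {p : E | ∀ w ∈ K, ⟪w - x, H.normal⟫ = 0 → ⟪w - x, H.incl p⟫ ≤ 1} =
      ⋃ v ∈ V.filter fun v => 0 < ⟪v - x, H.normal⟫, H.projectedFacet K x v := by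
  have hVK : ∀ v ∈ V, v ∈ K := fun v hv => hKV ▸ subset_convexHull ℝ _ hv
  have hKconv : Convex ℝ K := hKV ▸ convex_convexHull ℝ _
  have hhalf : ∀ (y : EuclideanSpace ℝ (Fin d)) (c : ℝ), (∀ v ∈ V, ⟪v, y⟫ ≤ c) →
      ∀ w ∈ K, ⟪w, y⟫ ≤ c := by
    intro y c h w hw
    have hconv : Convex ℝ {w : EuclideanSpace ℝ (Fin d) | ⟪w, y⟫ ≤ c} := by
      refine convex_halfSpace_le (f := fun w => ⟪w, y⟫) ?_ c
      exact ⟨fun a b => inner_add_left a b y, fun r a => real_inner_smul_left a y r⟩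
    rw [hKV] at hw
    exact convexHull_min (fun v hv => h v hv) hconv hw
  ext p
  simp only [mem_iUnion, Finset.mem_filter, exists_prop, projectedFacet, mem_ofPred_eq,
    mem_polar_cone_translateBy, sub_inner_div_eq]
  constructor
  · intro hp
    -- Otherwise the frame normal would be an outer normal of K at its interior point x.
    have hne : (V.filter fun v => 0 < ⟪v - x, H.normal⟫).Nonempty := by
      by_contra hemp
      rw [Finset.not_nonempty_iff_eq_empty, Finset.filter_eq_empty_iff] at hemp
      have hle := hhalf H.normal ⟪x, H.normal⟫ fun v hv => by
        have := hemp hv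
        rw [inner_sub_left] at this
        linarith
      have hnc : H.normal ∈ normalCone K x := fun y hy => by
        rw [inner_sub_right, real_inner_comm, real_inner_comm x]
        linarith [hle y hy]
      have h0 : H.normal ≠ 0 := by
        intro h0
        have := H.norm_normal
        rw [h0, norm_zero] at this
        exact zero_ne_one this
      have := inner_neg_of_mem_interior hnc h0 hx
      simp at this
    -- Moving from p along the normal, the constraint of w becomes tight at this height. The first
    -- to do so determines the facet above p.
    obtain ⟨v, hv, hmin⟩ := Finset.exists_min_image _
      (fun w => (1 - ⟪w - x, H.incl p⟫) / ⟪w - x, H.normal⟫) hne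
    rw [Finset.mem_filter] at hv
    refine ⟨v, hv, ?_⟩
    set t := (1 - ⟪v - x, H.incl p⟫) / ⟪v - x, H.normal⟫ with ht
    have hvy := H.inner_lift_eq_one hv.2 p
    rw [← ht] at hvy
    have hta : t * ⟪v - x, H.normal⟫ = 1 - ⟪v - x, H.incl p⟫ := div_mul_cancel₀ _ hv.2.ne'
    intro w hw
    rw [inner_sub_left, sub_nonpos]
    refine hhalf _ _ (fun w hw => ?_) w hw
    suffices h1 : ⟪w - x, H.incl p + t • H.normal⟫ ≤ 1 by
      rw [inner_sub_left] at h1 hvy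
      linarith
    rw [inner_add_right, inner_smul_right]
    rcases lt_trichotomy ⟪w - x, H.normal⟫ 0 with hneg | hzero | hpos
    -- For w behind the hyperplane, the segment from v to w crosses it inside K. The section bound
    -- there and equality at v yield the constraint of w.
    · have hab : 0 < ⟪v - x, H.normal⟫ - ⟪w - x, H.normal⟫ := by linarith
      have hm := hKconv (hVK v hv.1) (hVK w hw)
        (a := -⟪w - x, H.normal⟫ / (⟪v - x, H.normal⟫ - ⟪w - x, H.normal⟫))
        (b := ⟪v - x, H.normal⟫ / (⟪v - x, H.normal⟫ - ⟪w - x, H.normal⟫))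
        (div_nonneg (by linarith) hab.le) (div_nonneg hv.2.le hab.le)
        (by rw [← add_div, div_eq_one_iff_eq hab.ne']; ring)
      have hdecomp : ∀ (a b : ℝ), a + b = 1 →
          a • v + b • w - x = a • (v - x) + b • (w - x) := by
        intro a b h
        have : x = a • x + b • x := by rw [← add_smul, h, one_smul]
        conv_lhs => rw [this]
        module
      have hsum : -⟪w - x, H.normal⟫ / (⟪v - x, H.normal⟫ - ⟪w - x, H.normal⟫) +
          ⟪v - x, H.normal⟫ / (⟪v - x, H.normal⟫ - ⟪w - x, H.normal⟫) = 1 := by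
        rw [← add_div, div_eq_one_iff_eq hab.ne']
        ring
      have h1 := hp _ hm
      rw [hdecomp _ _ hsum] at h1
      simp only [inner_add_left, real_inner_smul_left] at h1
      generalize ⟪v - x, H.normal⟫ = a at *
      generalize ⟪w - x, H.normal⟫ = b at *
      generalize ⟪v - x, H.incl p⟫ = α at *
      generalize ⟪w - x, H.incl p⟫ = β at *
      have h2 := h1 (by field_simp; ring)
      have h3 : -b * α + a * β ≤ a - b := by
        have e : -b / (a - b) * α + a / (a - b) * β = (-b * α + a * β) / (a - b) := by ring
        rwa [e, div_le_one hab] at h2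
      have h4 : a * (β + t * b) ≤ a * 1 := by
        calc a * (β + t * b) = a * β + b * (t * a) := by ring
          _ = a * β + b * (1 - α) := by rw [hta]
          _ ≤ a * 1 := by linarith
      exact le_of_mul_le_mul_left h4 hv.2
    · rw [hzero, mul_zero, add_zero]
      exact hp w (hVK w hw) hzero
    · have := hmin w (Finset.mem_filter.2 ⟨hw, hpos⟩)
      rw [le_div_iff₀ hpos] at this
      linarith
  · rintro ⟨v, ⟨hv, hpos⟩, h⟩ w hw hw0
    have h1 := h w hw
    have h2 := H.inner_lift_eq_one hpos p
    have h3 : ⟪w - x, H.incl p⟫ = ⟪w - x, H.incl p +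
        ((1 - ⟪v - x, H.incl p⟫) / ⟪v - x, H.normal⟫) • H.normal⟫ := by
      rw [inner_add_right, inner_smul_right, hw0, mul_zero, add_zero]
    rw [h3, ← sub_add_sub_cancel w v x, inner_add_left, h2]
    linarith

/-- Over a common point the two facets have equal height, which is one affine equation on p. -/
theorem volume_projectedFacet_inter {v w : EuclideanSpace ℝ (Fin d)} (hvK : v ∈ K) (hwK : w ∈ K)
    (hv : 0 < ⟪v - x, H.normal⟫) (hw : 0 < ⟪w - x, H.normal⟫) (hne : v ≠ w) :
    volume (H.projectedFacet K x v ∩ H.projectedFacet K x w) = 0 := by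
  set a := ⟪v - x, H.normal⟫ with ha
  set b := ⟪w - x, H.normal⟫ with hb
  set q := a • (w - x) - b • (v - x) with hq
  have hle : ∀ {v w : EuclideanSpace ℝ (Fin d)}, w ∈ K → 0 < ⟪v - x, H.normal⟫ →
      0 < ⟪w - x, H.normal⟫ → ∀ p ∈ H.projectedFacet K x v,
      (1 - ⟪v - x, H.incl p⟫) / ⟪v - x, H.normal⟫ ≤
        (1 - ⟪w - x, H.incl p⟫) / ⟪w - x, H.normal⟫ := by
    intro v w hwK hv hw p hp
    rw [projectedFacet, mem_ofPred_eq, mem_polar_cone_translateBy, sub_inner_div_eq] at hp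
    have h1 := hp w hwK
    have h2 := H.inner_lift_eq_one hv p
    rw [le_div_iff₀ hw]
    rw [← sub_sub_sub_cancel_right w v x, inner_sub_left, h2, inner_add_right,
      inner_smul_right] at h1
    linarith
  have hsub : H.projectedFacet K x v ∩ H.projectedFacet K x w ⊆
      {p | ⟪H.coord q, p⟫ = a - b} := by
    rintro p ⟨hpv, hpw⟩
    have := le_antisymm (hle hwK hv hw p hpv) (hle hvK hw hv p hpw)
    rw [div_eq_div_iff hv.ne' hw.ne'] at this
    rw [mem_ofPred_eq, inner_coord, hq, inner_sub_left, real_inner_smul_left, real_inner_smul_left]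
    linarith
  -- If the linear part vanishes then q = 0, because q is also orthogonal to the normal. Then a = b
  -- would give v = w, so the equation has no solution.
  by_cases hq0 : H.coord q = 0
  · have hab : a - b ≠ 0 := by
      intro hab
      have hqn : ⟪H.normal, q⟫ = 0 := by
        rw [hq, inner_sub_right, inner_smul_right, inner_smul_right, real_inner_comm, ← hb,
          real_inner_comm, ← ha]
        ring
      have h1 := H.incl_coord q
      rw [hq0, hqn, map_zero, zero_smul, sub_zero] at h1
      rw [sub_eq_zero] at hab
      rw [hq, ← hab, ← smul_sub, sub_sub_sub_cancel_right] at h1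
      rcases smul_eq_zero.1 h1.symm with h2 | h2
      · exact hv.ne' h2
      · exact hne (sub_eq_zero.1 h2).symm
    refine measure_mono_null hsub ?_
    simp [hq0, hab.symm]
  · exact measure_mono_null hsub (volume_inner_eq_const hq0 _)

/-- Volume of the polar of a hyperplane section of a polytope, as a sum over the vertices. -/
theorem measure_polarIn_section (V : Finset (EuclideanSpace ℝ (Fin d)))
    (hKV : K = convexHull ℝ (V : Set (EuclideanSpace ℝ (Fin d)))) (hx : x ∈ interior K) :
    μHE[finrank ℝ E] (polarIn (ℝ ∙ H.normal)ᗮ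
        (finslerBall K x ∩ ((ℝ ∙ H.normal)ᗮ : Submodule ℝ (EuclideanSpace ℝ (Fin d))))) =
      ∑ v ∈ V, ENNReal.ofReal (⟪v - x, H.normal⟫ / ‖x - v‖) *
        μHE[finrank ℝ E] (dualCrossSection (cone (translateBy K v)) (x - v)) := by
  have hVK : ∀ v ∈ V, v ∈ K := fun v hv => hKV ▸ subset_convexHull ℝ _ hv
  have hKc : IsCompact K := hKV ▸ V.finite_toSet.isCompact_convexHull ℝ
  have himg : polarIn (ℝ ∙ H.normal)ᗮ
      (finslerBall K x ∩ ((ℝ ∙ H.normal)ᗮ : Submodule ℝ (EuclideanSpace ℝ (Fin d)))) =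
      H.incl '' {p : E | ∀ w ∈ K, ⟪w - x, H.normal⟫ = 0 → ⟪w - x, H.incl p⟫ ≤ 1} := by
    rw [finslerBall_eq hKc (hKV ▸ convex_convexHull ℝ _) hx]
    ext y
    simp only [polarIn, mem_inter_iff, SetLike.mem_coe, mem_ofPred_eq, mem_image,
      Submodule.mem_orthogonal_singleton_iff_inner_right]
    constructor
    · rintro ⟨hy0, hy⟩
      have hyc : H.incl (H.coord y) = y := by rw [incl_coord, hy0, zero_smul, sub_zero]
      refine ⟨H.coord y, fun w hw hw0 => ?_, hyc⟩
      rw [hyc]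
      exact hy _ ⟨by rwa [add_sub_cancel], by rwa [real_inner_comm]⟩
    · rintro ⟨p, hp, rfl⟩
      refine ⟨H.inner_normal_incl p, fun w hw => ?_⟩
      have := hp (x + w) hw.1
      rw [add_sub_cancel_left, real_inner_comm] at this
      exact this hw.2
  rw [himg, H.incl.isometry.euclideanHausdorffMeasure_image,
    InnerProductSpace.euclideanHausdorffMeasure_eq_volume,
    H.polar_section_eq_iUnion_projectedFacet V hKV hx, measure_biUnion_finset₀, Finset.sum_filter]
  · refine Finset.sum_congr rfl fun v _ => ?_
    split_ifs with h
    · exact H.volume_projectedFacet h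
    -- Truncation by `ENNReal.ofReal` removes the vertices not facing the normal, so the sum may run
    -- over all of V.
    · rw [ENNReal.ofReal_of_nonpos
        (div_nonpos_of_nonpos_of_nonneg (not_lt.1 h) (norm_nonneg _)), zero_mul]
  · intro v hv w hw hvw
    simp only [Finset.coe_filter, mem_ofPred_eq] at hv hw
    exact H.volume_projectedFacet_inter (hVK v hv.1) (hVK w hw.1) hv.2 hw.2 hvw
  · exact fun v _ => (H.isClosed_projectedFacet K x v).nullMeasurableSet

/-- Through the slice formula, the section measure is a measurable factor times the volume of the
fibre over `s` of a measurable set in a product. -/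
theorem exists_measurable_eq_measure_dualCrossSection (C : Set (EuclideanSpace ℝ (Fin d))) :
    ∃ f : EuclideanSpace ℝ (Fin d) → ℝ≥0∞, Measurable f ∧
      ∀ s, ⟪s, H.normal⟫ ≠ 0 → μHE[finrank ℝ E] (dualCrossSection C s) = f s := by
  refine ⟨_, ?_, fun s hs => H.measure_dualCrossSection s hs C⟩
  refine Measurable.mul ?_ ?_
  · fun_prop
  · have hm : MeasurableSet {z : EuclideanSpace ℝ (Fin d) × E |
        H.incl z.2 + ((-1 - ⟪z.1, H.incl z.2⟫) / ⟪z.1, H.normal⟫) • H.normal ∈ polar C} := by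
      have := H.incl.continuous.measurable
      exact (isClosed_polar C).measurableSet.preimage (by fun_prop)
    exact measurable_measure_prodMk_left hm

end HyperplaneFrame

end Duality

/-! ### From the boundary of G to the sphere of directions at a vertex -/

section ChangeOfVariables

variable {d : ℕ} {G : Set (EuclideanSpace ℝ (Fin d))} {v : EuclideanSpace ℝ (Fin d)}
  {E : Type*} [NormedAddCommGroup E] [InnerProductSpace ℝ E] [FiniteDimensional ℝ E]
  [MeasurableSpace E] [BorelSpace E] {H : HyperplaneFrame E (EuclideanSpace ℝ (Fin d))}

theorem measurableSet_visiblePart (G : Set (EuclideanSpace ℝ (Fin d)))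
    (v : EuclideanSpace ℝ (Fin d)) : MeasurableSet (visiblePart G v) := by
  have : visiblePart G v = frontier G ∩
      ⋃ s : {s : ℝ // 0 < s}, (fun x => x + s.1 • (x - v)) ⁻¹' interior G := by
    ext x
    simp [visiblePart]
  rw [this]
  exact isClosed_frontier.measurableSet.inter
    (isOpen_iUnion fun s => isOpen_interior.preimage (by fun_prop)).measurableSet

namespace HyperplaneFrame

/-- The radial projection of the chart onto the unit sphere. -/
noncomputable def direction (H : HyperplaneFrame E (EuclideanSpace ℝ (Fin d))) (z : E) :
    EuclideanSpace ℝ (Fin d) := ‖H.chart z‖⁻¹ • H.chart z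

theorem norm_direction (z : E) : ‖H.direction z‖ = 1 := by
  rw [direction, norm_smul, norm_inv, norm_norm, inv_mul_cancel₀ (H.norm_chart_pos z).ne']

theorem direction_injective : Function.Injective H.direction := by
  intro z w hzw
  refine (add_smul_chart_injective (H := H) (t' := ‖H.chart w‖⁻¹) (v := (0 : EuclideanSpace ℝ (Fin d)))
    (inv_ne_zero (H.norm_chart_pos z).ne') ?_).2
  rw [zero_add, zero_add]
  exact hzw

theorem hasFDerivAt_direction (z : E) : HasFDerivAt H.direction
    (‖H.chart z‖⁻¹ • H.incl.toContinuousLinearMap +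
      (fderiv ℝ (fun z => ‖H.chart z‖⁻¹) z).smulRight (H.chart z)) z := by
  have hne : H.chart z ≠ 0 := norm_pos_iff.1 (H.norm_chart_pos z)
  have hd : DifferentiableAt ℝ (fun z => ‖H.chart z‖⁻¹) z :=
    ((H.hasFDerivAt_chart z).differentiableAt.norm ℝ hne).inv (norm_ne_zero_iff.2 hne)
  have he : H.direction = fun z => 0 + ‖H.chart z‖⁻¹ • H.chart z := by
    ext1 z
    rw [zero_add, direction]
  rw [he]
  exact H.hasFDerivAt_cone 0 hd.hasFDerivAt

/-- The direction is a radial map with factor 1/|chart|, and the unit normal of its image is the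
direction itself; the cone Jacobian then reads |chart| · J = |chart|^(-n). -/
theorem normDet_fderiv_direction (z : E) : (fderiv ℝ H.direction z).toLinearMap.normDet =
    (‖H.chart z‖ ^ (finrank ℝ E + 1))⁻¹ := by
  have hpos := H.norm_chart_pos z
  have hd := H.hasFDerivAt_direction z
  have hort : ∀ w, ⟪H.direction z, fderiv ℝ H.direction z w⟫ = 0 := by
    intro w
    have h1 : HasFDerivAt (fun z => ⟪H.direction z, H.direction z⟫) _ z :=
      hd.differentiableAt.hasFDerivAt.inner ℝ hd.differentiableAt.hasFDerivAt
    have h2 : (fun z => ⟪H.direction z, H.direction z⟫) = fun _ => 1 := by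
      ext z
      rw [real_inner_self_eq_norm_sq, norm_direction, one_pow]
    rw [h2] at h1
    have h3 := congrArg (fun L => L w) (h1.unique (hasFDerivAt_const 1 z))
    simp only [ContinuousLinearMap.comp_apply, ContinuousLinearMap.prod_apply, fderivInnerCLM_apply,
      zero_apply] at h3
    rw [real_inner_comm]
    linarith [real_inner_comm (H.direction z) (fderiv ℝ H.direction z w)]
  rw [hd.fderiv] at hort ⊢
  have := H.abs_inner_mul_normDet_cone z (inv_pos.2 hpos)
    (fderiv ℝ (fun z => ‖H.chart z‖⁻¹) z).toLinearMap (norm_direction (H := H) z) hort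
  rw [direction, real_inner_smul_left, real_inner_self_eq_norm_sq, sq, inv_mul_cancel_left₀ hpos.ne',
    abs_norm] at this
  have h4 : ‖H.chart z‖ * (‖H.chart z‖⁻¹ • H.incl.toContinuousLinearMap +
      (fderiv ℝ (fun z => ‖H.chart z‖⁻¹) z).smulRight (H.chart z)).toLinearMap.normDet =
      ‖H.chart z‖⁻¹ ^ finrank ℝ E := this
  rw [pow_succ, mul_inv, ← inv_pow, ← h4]
  field_simp

namespace Sees

theorem sphere_inter_cone (h : H.Sees G v) :
    sphere 0 1 ∩ cone (translateBy G v) = H.direction '' H.shadow G v := by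
  ext s
  constructor
  · rintro ⟨hs, γ, hγ, _, ⟨x, hx, rfl⟩, rfl⟩
    obtain ⟨δ, hδ, hb⟩ := h.pos
    have ht : 0 < ⟪H.normal, x - v⟫ := hδ.trans_le (hb x hx)
    have hxe := H.exists_eq_add_smul_chart ht
    set t := ⟪H.normal, x - v⟫
    set z := t⁻¹ • H.coord (x - v)
    refine ⟨z, ⟨t, hxe ▸ hx⟩, ?_⟩
    have hxv : x - v = t • H.chart z := sub_eq_iff_eq_add'.2 hxe
    rw [mem_sphere_zero_iff_norm] at hs
    simp only [hxv, smul_smul] at hs ⊢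
    have hγt : 0 ≤ γ * t := mul_nonneg hγ ht.le
    rw [norm_smul, Real.norm_eq_abs, abs_of_nonneg hγt] at hs
    rw [direction, eq_inv_of_mul_eq_one_left hs]
  · rintro ⟨z, ⟨t, ht⟩, rfl⟩
    refine ⟨by rw [mem_sphere_zero_iff_norm, norm_direction], ‖H.chart z‖⁻¹ * t⁻¹, ?_, _,
      mem_image_of_mem _ ht, ?_⟩
    · have := h.pos_of_mem ht
      positivity
    · rw [add_sub_cancel_left, smul_smul, mul_assoc, inv_mul_cancel₀ (h.pos_of_mem ht).ne', mul_one,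
        direction]

/-- Integration over a convex patch of the unit sphere in a central chart. -/
theorem lintegral_sphere_inter_cone (h : H.Sees G v) (hi : (interior G).Nonempty)
    (f : EuclideanSpace ℝ (Fin d) → ℝ≥0∞) :
    ∫⁻ s in sphere 0 1 ∩ cone (translateBy G v), f s ∂μHE[finrank ℝ E] =
      ∫⁻ z in H.smoothShadow G v,
        ENNReal.ofReal (‖H.chart z‖ ^ (finrank ℝ E + 1))⁻¹ * f (H.direction z) := by
  have hinj : ∀ z : E, Function.Injective (fderiv ℝ H.direction z) := fun z => by
    rw [(H.hasFDerivAt_direction z).fderiv]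
    exact H.cone_fderiv_injective z (inv_ne_zero (H.norm_chart_pos z).ne') _
  rw [h.sphere_inter_cone, lintegral_image_eq_lintegral_normDet_mul
    h.isCompact_shadow.isClosed.measurableSet
    (fun z _ => (H.hasFDerivAt_direction z).differentiableAt.hasFDerivAt.hasFDerivWithinAt)
    (measurable_fderiv ℝ _).aemeasurable (fun z _ => hinj z) direction_injective.injOn]
  simp only [normDet_fderiv_direction]
  refine setLIntegral_congr ?_
  have hsub : H.smoothShadow G v ⊆ H.shadow G v := fun z hz => shadow_mono interior_subset hz.1
  refine Filter.EventuallyLE.antisymm (ae_le_set.2 ?_) hsub.eventuallyLE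
  refine measure_mono_null (fun z hz => ?_)
    (measure_union_null (h.volume_shadow_diff hi) h.volume_diff_smoothShadow)
  by_cases hz' : z ∈ H.shadow (interior G) v
  · exact Or.inr ⟨hz', hz.2⟩
  · exact Or.inl ⟨hz.1, hz'⟩

/-- Integration over the visible part of the boundary in a central chart. -/
theorem lintegral_visiblePart (h : H.Sees G v) (f : EuclideanSpace ℝ (Fin d) → ℝ≥0∞) :
    ∫⁻ x in visiblePart G v, f x ∂μHE[finrank ℝ E] =
      ∫⁻ z in H.smoothShadow G v,
        ENNReal.ofReal (H.entryDeriv G v z).toLinearMap.normDet * f (H.entry G v z) := by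
  have hsub : H.smoothShadow G v ⊆ H.shadow G v := fun z hz => shadow_mono interior_subset hz.1
  have hfd : ∀ z ∈ H.smoothShadow G v, fderiv ℝ (H.entry G v) z = H.entryDeriv G v z :=
    fun z hz => (hasFDerivAt_entry hz.2).fderiv
  have hae : visiblePart G v =ᵐ[μHE[finrank ℝ E]] H.entry G v '' H.smoothShadow G v := by
    refine Filter.EventuallyLE.antisymm (ae_le_set.2 h.measure_visiblePart_diff)
      (LE.le.eventuallyLE ?_)
    rw [← h.image_entry]
    exact image_mono fun z hz => hz.1
  rw [setLIntegral_congr hae, lintegral_image_eq_lintegral_normDet_mul measurableSet_smoothShadow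
    (fun z hz => (hasFDerivAt_entry hz.2).differentiableAt.hasFDerivAt.hasFDerivWithinAt)
    (measurable_fderiv ℝ _).aemeasurable ?_ (h.injOn_entry.mono hsub)]
  · refine setLIntegral_congr_fun measurableSet_smoothShadow fun z hz => ?_
    simp only [hfd z hz]
  · intro z hz
    rw [hfd z hz]
    exact H.cone_fderiv_injective z (h.radius_pos (hsub hz)).ne' _

/-- Write r for the radius, ζ for the chart vector and N for the normal. The Jacobian is r^n / (-⟨N,
ζ⟩), the cosine is -⟨N, ζ⟩ / |ζ|, and homogeneity of the section gives (r |ζ|)^(-n). Both r and N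
cancel, leaving the Jacobian of the direction map. -/
theorem normDet_entryDeriv_mul (h : H.Sees G v) {z : E} (hz : z ∈ H.smoothShadow G v)
    (A : Set (EuclideanSpace ℝ (Fin d))) :
    ENNReal.ofReal (H.entryDeriv G v z).toLinearMap.normDet *
        (ENNReal.ofReal (⟪v - H.entry G v z, outerNormal G (H.entry G v z)⟫ /
          ‖H.entry G v z - v‖) *
        μHE[finrank ℝ E] (dualCrossSection (cone A) (H.entry G v z - v))) =
      ENNReal.ofReal (‖H.chart z‖ ^ (finrank ℝ E + 1))⁻¹ *
        μHE[finrank ℝ E] (dualCrossSection (cone A) (H.direction z)) := by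
  have hr := h.radius_pos (shadow_mono interior_subset hz.1)
  have hc := H.norm_chart_pos z
  have hN := isUniqueNormal_outerNormal (h.exists_isUniqueNormal hz.1 hz.2)
  set N := outerNormal G (H.entry G v z)
  have hneg := h.inner_chart_neg hz.1 hN.mem_normalCone hN.ne_zero
  have hJ : |⟪N, H.chart z⟫| * (H.entryDeriv G v z).toLinearMap.normDet =
      H.radius G v z ^ finrank ℝ E :=
    H.abs_inner_mul_normDet_cone z hr (fderiv ℝ (H.radius G v) z).toLinearMap hN.norm_eq_one
      (h.inner_entryDeriv hz.1 hz.2 hN.mem_normalCone)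
  rw [abs_of_neg hneg] at hJ
  have hev : H.entry G v z - v = H.radius G v z • H.chart z := by
    rw [entry, add_sub_cancel_left]
  have hev' : H.entry G v z - v = (H.radius G v z * ‖H.chart z‖) • H.direction z := by
    rw [hev, direction, smul_smul, mul_inv_cancel_right₀ hc.ne']
  have hve : ⟪v - H.entry G v z, N⟫ = H.radius G v z * -⟪N, H.chart z⟫ := by
    rw [← neg_sub, inner_neg_left, hev, real_inner_smul_left, real_inner_comm]
    ring
  have hnorm : ‖H.entry G v z - v‖ = H.radius G v z * ‖H.chart z‖ := by
    rw [hev, norm_smul, Real.norm_eq_abs, abs_of_pos hr]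
  rw [hve, hnorm, hev', euclideanHausdorffMeasure_dualCrossSection_smul _ _ _ (by positivity),
    ← mul_assoc, ← mul_assoc, ← ENNReal.ofReal_mul (LinearMap.normDet_nonneg _),
    ← ENNReal.ofReal_mul (mul_nonneg (LinearMap.normDet_nonneg _) (div_nonneg
      (mul_nonneg hr.le (by linarith)) (by positivity)))]
  congr 2
  calc _ = (-⟪N, H.chart z⟫ * (H.entryDeriv G v z).toLinearMap.normDet) *
        (H.radius G v z / (H.radius G v z * ‖H.chart z‖)) *
        (H.radius G v z * ‖H.chart z‖)⁻¹ ^ finrank ℝ E := by ring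
    _ = _ := by
      rw [hJ, mul_inv, mul_pow, inv_pow, inv_pow, pow_succ]
      field_simp

end Sees

end HyperplaneFrame

variable (E) in
/-- The contribution of a single vertex: an integral over the boundary of `G` of the facet areas
is an integral over the directions in which `G` is seen from the vertex. -/
theorem lintegral_frontier_eq_lintegral_sphere_inter_cone (hdim : d = finrank ℝ E + 1)
    (hG : IsConvexBody G) (hv : v ∉ G) (A : Set (EuclideanSpace ℝ (Fin d))) :
    ∫⁻ x in frontier G, ENNReal.ofReal (⟪v - x, outerNormal G x⟫ / ‖x - v‖) *
        μHE[finrank ℝ E] (dualCrossSection (cone A) (x - v)) ∂μHE[finrank ℝ E] =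
      ∫⁻ s in sphere 0 1 ∩ cone (translateBy G v),
        μHE[finrank ℝ E] (dualCrossSection (cone A) s) ∂μHE[finrank ℝ E] := by
  obtain ⟨H, h⟩ := exists_sees (E := E) hdim hG hv
  rw [h.lintegral_sphere_inter_cone hG.2.2]
  -- Where the normal is unique, an invisible point has ⟨v - x, N⟩ ≤ 0, so truncation makes the
  -- integrand vanish.
  have hind : ∀ᵐ x ∂(μHE[finrank ℝ E] : Measure (EuclideanSpace ℝ (Fin d))).restrict (frontier G),
      ENNReal.ofReal (⟪v - x, outerNormal G x⟫ / ‖x - v‖) *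
        μHE[finrank ℝ E] (dualCrossSection (cone A) (x - v)) =
      (visiblePart G v).indicator (fun x =>
        ENNReal.ofReal (⟪v - x, outerNormal G x⟫ / ‖x - v‖) *
          μHE[finrank ℝ E] (dualCrossSection (cone A) (x - v))) x := by
    have hae : ∀ᵐ x ∂(μHE[finrank ℝ E] : Measure (EuclideanSpace ℝ (Fin d))),
        x ∈ frontier G → ∃ u, IsUniqueNormal G x u :=
      measure_mono_null (fun x hx => by simpa using hx) (measure_not_isUniqueNormal E hdim hG)
    rw [ae_restrict_iff' isClosed_frontier.measurableSet]
    filter_upwards [hae] with x hx hxf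
    by_cases hxv : x ∈ visiblePart G v
    · rw [indicator_of_mem hxv]
    · rw [indicator_of_notMem hxv]
      rw [(isUniqueNormal_outerNormal (hx hxf)).mem_visiblePart_iff hG.2.1 hG.2.2 hxf
        (hG.1.isClosed.frontier_subset hxf)] at hxv
      rw [ENNReal.ofReal_of_nonpos
        (div_nonpos_of_nonpos_of_nonneg (not_lt.1 hxv) (norm_nonneg _)), zero_mul]
  have hsub : visiblePart G v ∩ frontier G = visiblePart G v :=
    inter_eq_left.2 fun x hx => hx.1
  rw [lintegral_congr_ae hind, setLIntegral_indicator (measurableSet_visiblePart G v), hsub,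
    h.lintegral_visiblePart]
  exact setLIntegral_congr_fun HyperplaneFrame.measurableSet_smoothShadow
    fun z hz => h.normDet_entryDeriv_mul hz A

variable (E) in
-- This permits exchanging the sum over vertices with the integral. The normal is continuous off a
-- null set, and x - v is never orthogonal to the frame normal when x lies in G.
theorem aemeasurable_facet_term (hdim : d = finrank ℝ E + 1) (hG : IsConvexBody G) (hv : v ∉ G)
    (C : Set (EuclideanSpace ℝ (Fin d))) :
    AEMeasurable (fun x => ENNReal.ofReal (⟪v - x, outerNormal G x⟫ / ‖x - v‖) *
      μHE[finrank ℝ E] (dualCrossSection C (x - v)))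
      ((μHE[finrank ℝ E] : Measure (EuclideanSpace ℝ (Fin d))).restrict (frontier G)) := by
  set μ := (μHE[finrank ℝ E] : Measure (EuclideanSpace ℝ (Fin d)))
  have hN : AEMeasurable (outerNormal G) (μ.restrict (frontier G)) := by
    set T := toMeasurable μ {x | x ∈ frontier G ∧ ¬ ∃ u, IsUniqueNormal G x u}
    have hT : μ T = 0 := by
      rw [measure_toMeasurable]
      exact measure_not_isUniqueNormal E hdim hG
    have hm : MeasurableSet (frontier G \ T) :=
      isClosed_frontier.measurableSet.diff (measurableSet_toMeasurable _ _)
    have hc : ContinuousOn (outerNormal G) (frontier G \ T) :=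
      continuousOn_outerNormal.mono fun x hx => by
        by_contra hn
        exact hx.2 (subset_toMeasurable _ _ ⟨hx.1, hn⟩)
    have := hc.aemeasurable (μ := μ) hm
    rwa [Measure.restrict_congr_set (sdiff_null_ae_eq_self hT)] at this
  obtain ⟨H, h⟩ := exists_sees (E := E) hdim hG hv
  obtain ⟨f, hf, hfs⟩ := H.exists_measurable_eq_measure_dualCrossSection C
  refine AEMeasurable.mul ?_ ⟨fun x => f (x - v), by fun_prop, ?_⟩
  · fun_prop
  · filter_upwards [ae_restrict_mem isClosed_frontier.measurableSet] with x hx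
    obtain ⟨δ, hδ, hb⟩ := h.pos
    refine hfs _ ?_
    rw [real_inner_comm]
    exact (hδ.trans_le (hb x (hG.1.isClosed.frontier_subset hx))).ne'

end ChangeOfVariables

/-! ### Summation over the vertices -/

section Decomposition

variable {d : ℕ} {K G : Set (EuclideanSpace ℝ (Fin d))}

theorem areaDensity_eq_sum (hd : 1 ≤ d) (V : Finset (EuclideanSpace ℝ (Fin d)))
    (hKV : K = convexHull ℝ (V : Set (EuclideanSpace ℝ (Fin d)))) {x : EuclideanSpace ℝ (Fin d)}
    (hx : x ∈ interior K) (hN : ∃ u, IsUniqueNormal G x u) :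
    areaDensity K G x = (unitBallVolume (d - 1))⁻¹ *
      ∑ v ∈ V, ENNReal.ofReal (⟪v - x, outerNormal G x⟫ / ‖x - v‖) *
        μHE[d - 1] (dualCrossSection (cone (translateBy K v)) (x - v)) := by
  have hu := isUniqueNormal_outerNormal hN
  obtain ⟨H, hH⟩ := exists_hyperplaneFrame (E := EuclideanSpace ℝ (Fin (d - 1)))
    (F := EuclideanSpace ℝ (Fin d)) (by simp; omega) hu.norm_eq_one
  have := H.measure_polarIn_section V hKV hx
  rw [finrank_euclideanSpace_fin, hH, ← hu.tangentSpace_eq] at this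
  rw [areaDensity, this]

/-- An interior point is the midpoint of a nondegenerate segment in K; `1 ≤ d` provides a nonzero
direction. -/
theorem extremePoint_notMem_interior (hd : 1 ≤ d) {v : EuclideanSpace ℝ (Fin d)}
    (hv : v ∈ K.extremePoints ℝ) : v ∉ interior K := by
  intro hi
  obtain ⟨w, hw⟩ : ∃ w : EuclideanSpace ℝ (Fin d), w ≠ 0 := by
    have : Nonempty (Fin d) := ⟨⟨0, hd⟩⟩
    exact exists_ne 0
  have hop : IsOpen {t : ℝ | v + t • w ∈ interior K ∧ v - t • w ∈ interior K} :=
    (isOpen_interior.preimage (by fun_prop : Continuous fun t : ℝ => v + t • w)).inter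
      (isOpen_interior.preimage (by fun_prop : Continuous fun t : ℝ => v - t • w))
  obtain ⟨ε, hε, hball⟩ := Metric.isOpen_iff.1 hop 0 (by simpa using hi)
  have hm := @hball (ε / 2) (by
    rw [mem_ball, Real.dist_eq, sub_zero, abs_of_pos (half_pos hε)]
    exact half_lt_self hε)
  have := hv.2 (interior_subset hm.1) (interior_subset hm.2)
    ⟨1 / 2, 1 / 2, by norm_num, by norm_num, by norm_num, by module⟩
  rw [add_eq_left, smul_eq_zero] at this
  exact this.elim (half_pos hε).ne' hw

theorem unitBallVolume_ne_zero (k : ℕ) : unitBallVolume k ≠ 0 :=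
  (measure_closedBall_pos volume _ one_pos).ne'

theorem area_eq_sum_coneVolume (hd : 1 ≤ d) (V : Finset (EuclideanSpace ℝ (Fin d)))
    (hKV : K = convexHull ℝ (V : Set (EuclideanSpace ℝ (Fin d)))) (hG : IsConvexBody G)
    (hGK : G ⊆ interior K) (hVG : ∀ v ∈ V, v ∉ G) :
    area K G = ∑ v ∈ V, coneVolume (cone (translateBy K v)) (cone (translateBy G v)) := by
  have hfr : finrank ℝ (EuclideanSpace ℝ (Fin (d - 1))) = d - 1 := finrank_euclideanSpace_fin
  have hdim : d = finrank ℝ (EuclideanSpace ℝ (Fin (d - 1))) + 1 := by omega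
  have hω : (unitBallVolume (d - 1))⁻¹ ≠ ⊤ := ENNReal.inv_ne_top.2 (unitBallVolume_ne_zero _)
  have hsing := measure_not_isUniqueNormal (EuclideanSpace ℝ (Fin (d - 1))) hdim hG
  have hmeas := fun v (hv : v ∈ V) => aemeasurable_facet_term (EuclideanSpace ℝ (Fin (d - 1)))
    hdim hG (hVG v hv) (cone (translateBy K v))
  have hint := fun v (hv : v ∈ V) => lintegral_frontier_eq_lintegral_sphere_inter_cone
    (EuclideanSpace ℝ (Fin (d - 1))) hdim hG (hVG v hv) (translateBy K v)
  rw [hfr] at hsing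
  simp only [hfr] at hmeas hint
  have hae : ∀ᵐ x ∂(μHE[d - 1] : Measure (EuclideanSpace ℝ (Fin d))),
      x ∈ frontier G → ∃ u, IsUniqueNormal G x u :=
    measure_mono_null (fun x hx => by simpa using hx) hsing
  have hdens : ∀ᵐ x ∂(μHE[d - 1] : Measure (EuclideanSpace ℝ (Fin d))).restrict (frontier G),
      areaDensity K G x = (unitBallVolume (d - 1))⁻¹ *
        ∑ v ∈ V, ENNReal.ofReal (⟪v - x, outerNormal G x⟫ / ‖x - v‖) *
          μHE[d - 1] (dualCrossSection (cone (translateBy K v)) (x - v)) := by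
    rw [ae_restrict_iff' isClosed_frontier.measurableSet]
    filter_upwards [hae] with x hx hxf
    exact areaDensity_eq_sum hd V hKV (hGK (hG.1.isClosed.frontier_subset hxf)) (hx hxf)
  rw [area, lintegral_congr_ae hdens, lintegral_const_mul' _ _ hω, lintegral_finsetSum' _ hmeas,
    Finset.mul_sum]
  refine Finset.sum_congr rfl fun v hv => ?_
  rw [coneVolume, hint v hv]

end Decomposition

end Funk

theorem theorem2 (d : ℕ) (hd : 1 ≤ d) (K G : Set (EuclideanSpace ℝ (Fin d)))
    (hK : Funk.IsConvexPolytope K) (hG : Funk.IsConvexBody G) (hGK : G ⊆ interior K) :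
    Funk.area K G =
      ∑' v : Funk.vertices K,
        Funk.coneVolume (Funk.cone (Funk.translateBy K v)) (Funk.cone (Funk.translateBy G v)) := by
  obtain ⟨S, hS⟩ := hK
  have hfin : (Funk.vertices K).Finite :=
    S.finite_toSet.subset (by rw [Funk.vertices, hS]; exact extremePoints_convexHull_subset)
  have hKc : IsCompact K := hS ▸ S.finite_toSet.isCompact_convexHull ℝ
  -- Krein–Milman; the hull of finitely many extreme points is already closed.
  have hKV : K = convexHull ℝ (hfin.toFinset : Set (EuclideanSpace ℝ (Fin d))) := by
    rw [hfin.coe_toFinset, ← (hfin.isCompact_convexHull ℝ).isClosed.closure_eq]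
    exact (closure_convexHull_extremePoints hKc (hS ▸ convex_convexHull ℝ _)).symm
  rw [Funk.area_eq_sum_coneVolume hd hfin.toFinset hKV hG hGK fun v hv hvG =>
    Funk.extremePoint_notMem_interior hd (hfin.mem_toFinset.1 hv) (hGK hvG)]
  conv_rhs => rw [← hfin.coe_toFinset]
  exact (Finset.tsum_subtype' hfin.toFinset fun v =>
    Funk.coneVolume (Funk.cone (Funk.translateBy K v)) (Funk.cone (Funk.translateBy G v))).symm
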